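/- Let $X$ be a (real or complex) Banach space, $1<\alpha<2$, $r>0$, and put $g_\beta(t)=t^{\beta-1}/\Gamma(\beta)$ for $\beta>0$, $t>0$, and $(g_\beta*h)(t)=\int_0^t g_\beta(t-s)h(s)\,ds$. Let $A$ be a closed, densely defined linear operator on $X$ generating an $\alpha$-times resolvent family $\{S_\alpha(t)\}_{t\ge0}\subset B(X)$; that is, $S_\alpha$ is strongly continuous on $[0,\infty)$, $S_\alpha(0)=I$, and for all $x\in D(A)$ and $t\ge0$ one has $S_\alpha(t)x\in D(A)$, $AS_\alpha(t)x=S_\alpha(t)Ax$ and $S_\alpha(t)x=x+\int_0^t g_\alpha(t-s)S_\alpha(s)Ax\,ds$. Put $P_\alpha(t)z=\int_0^t g_{\alpha-1}(t-s)S_\alpha(s)z\,ds$ for $z\in X$. For $x,y\in D(A)$ and $f\in C([0,r];X)$ consider the problem $$\mathbf D_t^\alpha u(t)=Au(t)+f(t)\quad(t\in[0,r]),\qquad u(0)=x,\quad u'(0)=y, \qquad (*)$$ with the Caputo derivative $\mathbf D_t^\alpha u=\frac{d^2}{dt^2}\bigl[g_{2-\alpha}*(u-u(0)-u'(0)g_2)\bigr]$.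 A strong solution of $(*)$ is a function $u\in C([0,r];D(A))\cap C^1([0,r];X)$, where $D(A)$ carries the graph norm, such that $g_{2-\alpha}*(u-x-g_2y)\in C^2([0,r];X)$ and $(*)$ holds on $[0,r]$. The family $S_\alpha$ is of bounded semivariation on $[0,r]$ if $$\sup\Bigl\|\sum_{i=1}^n\bigl[S_\alpha(d_i)-S_\alpha(d_{i-1})\bigr]x_i\Bigr\|<\infty,$$ the supremum being over all subdivisions $0=d_0<d_1<\cdots<d_n=r$ and all $x_1,\dots,x_n\in X$ with $\|x_i\|\le1$. Theorem. The function $$u(t)=S_\alpha(t)x+\int_0^tS_\alpha(s)y\,ds+\int_0^tP_\alpha(t-s)f(s)\,ds$$ is a strong solution of $(*)$ for all $x,y\in D(A)$ and all $f\in C([0,r];X)$ if and only if $S_\alpha$ is of bounded semivariation on $[0,r]$. Likewise, problem $(*)$ has maximal regularity on $C([0,r];X)$, meaning that for all $x,y\in D(A)$ and all $f\in C([0,r];X)$ it has a unique strong solution, if and only if $S_\alpha$ is of bounded semivariation on $[0,r]$. -/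

import Mathlib

open Set

/-- The kernel `g_β(t) = t^(β-1) / Γ(β)`, used for `β > 0` and `t > 0`. -/
noncomputable def fracKernel (β t : ℝ) : ℝ := t ^ (β - 1) / Real.Gamma β

/-- The convolution `(g_β * f)(t) = ∫₀ᵗ g_β(t - s) f(s) ds`. -/
noncomputable def fracConv {X : Type*} [NormedAddCommGroup X] [NormedSpace ℝ X]
    (β : ℝ) (f : ℝ → X) (t : ℝ) : X :=
  ∫ s in (0 : ℝ)..t, fracKernel β (t - s) • f s

/-- The Caputo derivative of order `α ∈ (1,2)` on `[0,r]`, in its relaxed form: the second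
derivative of `g_{2-α} * (u - u(0) - u'(0) g_2)`, where `g_2(t) = t`. The derivatives are taken
within `[0,r]`, hence one-sided at the end points. -/
noncomputable def caputoDeriv {X : Type*} [NormedAddCommGroup X] [NormedSpace ℝ X]
    (α r : ℝ) (u : ℝ → X) (t : ℝ) : X :=
  iteratedDerivWithin 2
    (fracConv (2 - α) (fun s => u s - u 0 - s • derivWithin u (Icc 0 r) 0)) (Icc 0 r) t

/-- `S`, of which only the values `S t` with `0 ≤ t` matter, is an `α`-times resolvent family
generated by the closed densely defined operator `A`. -/
structure IsResolventFamily {𝕜 X : Type*} [RCLike 𝕜] [NormedAddCommGroup X]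
    [NormedSpace ℝ X] [NormedSpace 𝕜 X]
    (α : ℝ) (A : X →ₗ.[𝕜] X) (S : ℝ → X →L[𝕜] X) : Prop where
  isClosed : A.IsClosed
  dense_domain : Dense (A.domain : Set X)
  strongly_continuous : ∀ x : X, ContinuousOn (fun t => S t x) (Ici 0)
  map_zero : S 0 = ContinuousLinearMap.id 𝕜 X
  commutes : ∀ t : ℝ, 0 ≤ t → ∀ x : A.domain,
    ∃ h : S t x ∈ A.domain, A ⟨S t x, h⟩ = S t (A x)
  resolvent_eq : ∀ t : ℝ, 0 ≤ t → ∀ x : A.domain,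
    S t x = (x : X) + fracConv α (fun s => S s (A x)) t

/-- `P_α(t) x = (g_{α-1} * S)(t) x = ∫₀ᵗ g_{α-1}(t - s) S(s) x ds`. -/
noncomputable def resolventP {𝕜 X : Type*} [RCLike 𝕜] [NormedAddCommGroup X]
    [NormedSpace ℝ X] [NormedSpace 𝕜 X]
    (α : ℝ) (S : ℝ → X →L[𝕜] X) (t : ℝ) (x : X) : X :=
  fracConv (α - 1) (fun s => S s x) t

/-- The function `S(t)x + ∫₀ᵗ S(s)y ds + (P_α * f)(t)`, where
`(P_α * f)(t) = ∫₀ᵗ P_α(t - s) f(s) ds`. -/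
noncomputable def candidateSolution {𝕜 X : Type*} [RCLike 𝕜] [NormedAddCommGroup X]
    [NormedSpace ℝ X] [NormedSpace 𝕜 X]
    (α : ℝ) (S : ℝ → X →L[𝕜] X) (x y : X) (f : ℝ → X) (t : ℝ) : X :=
  S t x + (∫ s in (0 : ℝ)..t, S s y) + ∫ s in (0 : ℝ)..t, resolventP α S (t - s) (f s)

/-- `u` is a strong solution on `[0,r]` of `D_t^α u = A u + f`, `u(0) = x`, `u'(0) = y`.
The first two fields say that `u`, which is continuous by the third, is continuous into `D(A)`
with the graph norm. -/
structure IsStrongSolution {𝕜 X : Type*} [RCLike 𝕜] [NormedAddCommGroup X]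
    [NormedSpace ℝ X] [NormedSpace 𝕜 X]
    (α r : ℝ) (A : X →ₗ.[𝕜] X) (x y : X) (f u : ℝ → X) : Prop where
  mem_domain : ∀ t ∈ Icc 0 r, u t ∈ A.domain
  continuous_map : Continuous (fun t : Icc (0 : ℝ) r => A ⟨u t, mem_domain t t.2⟩)
  contDiffOn_one : ContDiffOn ℝ 1 u (Icc 0 r)
  contDiffOn_two :
    ContDiffOn ℝ 2 (fracConv (2 - α) (fun s => u s - x - s • y)) (Icc 0 r)
  initial : u 0 = x
  initial_deriv : derivWithin u (Icc 0 r) 0 = y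
  equation : ∀ t (ht : t ∈ Icc 0 r),
    caputoDeriv α r u t = A ⟨u t, mem_domain t ht⟩ + f t

/-- Maximal regularity on `C([0,r];X)`: for all `x, y ∈ D(A)` and every continuous `f` there is
a unique strong solution on `[0,r]`. -/
def HasMaximalRegularity {𝕜 X : Type*} [RCLike 𝕜] [NormedAddCommGroup X]
    [NormedSpace ℝ X] [NormedSpace 𝕜 X]
    (α r : ℝ) (A : X →ₗ.[𝕜] X) : Prop :=
  ∀ x ∈ A.domain, ∀ y ∈ A.domain, ∀ f : ℝ → X, ContinuousOn f (Icc 0 r) →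
    ∃ u : ℝ → X, IsStrongSolution α r A x y f u ∧
      ∀ v : ℝ → X, IsStrongSolution α r A x y f v → EqOn v u (Icc 0 r)

/-- A subdivision `a = d₀ < d₁ < ⋯ < dₙ = b` of `[a,b]`. -/
structure Subdivision (a b : ℝ) where
  n : ℕ
  d : Fin (n + 1) → ℝ
  strictMono : StrictMono d
  first : d 0 = a
  last : d (Fin.last n) = b

open scoped ENNReal in
/-- `SV_d[G]`, the supremum of `‖∑ᵢ (G(dᵢ) - G(dᵢ₋₁)) xᵢ‖` over all `xᵢ` with `‖xᵢ‖ ≤ 1`. -/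
noncomputable def semivariationOn {𝕜 X : Type*} [RCLike 𝕜] [NormedAddCommGroup X]
    [NormedSpace 𝕜 X] {a b : ℝ} (G : ℝ → X →L[𝕜] X) (p : Subdivision a b) : ℝ≥0∞ :=
  ⨆ (x : Fin p.n → X) (_ : ∀ i, ‖x i‖ ≤ 1),
    ‖∑ i : Fin p.n, (G (p.d i.succ) - G (p.d i.castSucc)) (x i)‖ₑ

open scoped ENNReal in
/-- `SV[G]`, the semivariation of `G` on `[a,b]`. -/
noncomputable def semivariation {𝕜 X : Type*} [RCLike 𝕜] [NormedAddCommGroup X]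
    [NormedSpace 𝕜 X] (a b : ℝ) (G : ℝ → X →L[𝕜] X) : ℝ≥0∞ :=
  ⨆ p : Subdivision a b, semivariationOn G p

/-- `G` is of bounded semivariation on `[a,b]`. -/
def HasBoundedSemivariation {𝕜 X : Type*} [RCLike 𝕜] [NormedAddCommGroup X]
    [NormedSpace 𝕜 X] (a b : ℝ) (G : ℝ → X →L[𝕜] X) : Prop :=
  semivariation a b G < ⊤

open Set MeasureTheory Filter Topology

-- Write `*` for convolution on `[0,t]`, with `1 * h` the primitive of `h`. By the law `g_a * g_b =
-- g_{a+b}`, strong solutions are the solutions of the integrated equation `u = x + t y + g_α * m`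
-- with `m = Au + f` continuous (`isStrongSolution_of_eq_fracConv`,
-- `IsStrongSolution.exists_eq_fracConv`). The resolvent equation gives `A(g_α * S * f) = S * f - 1
-- * f` for every continuous `f`. It follows that a solution with zero data must be `P_α * f =
-- g_{α-1} * (S * f)` (`eq_fracConv_opConv`), which also yields uniqueness. If moreover `S * f = 1 *
-- k` with `k` continuous, then `P_α * f = g_α * k`, and differentiating the identity gives `A(P_α *
-- f) = k - f`. So everything turns on whether `S * f` is `C¹`.
--
-- Sufficiency: for `f` of class `C¹`, `(S * f)' = S f(0) + S * f'`. Abel summation turns Riemann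
-- sums of `S * f'` into the sums that define the semivariation, so `‖(S * f)' - f‖ ≤ B sup ‖f‖`
-- (`norm_apply_add_opConv_sub_le`). Approximation by `C¹` functions extends the conclusion to
-- continuous `f`.
--
-- Necessity: if `(P_α * f)(r)` always lies in `D(A)`, then `f ↦ A(P_α * f)(r)` is bounded, by the
-- open mapping theorem. On a smoothed step function with values in the convex hull of `0` and the
-- `xᵢ`, this map tends to `∑ (S(dᵢ) - S(dᵢ₋₁)) xᵢ` as the smoothing is removed
-- (`exists_semivariationLE`).

universe u

/-! ### Fractional and operator convolutions: continuity and Fubini. -/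

section

variable {X : Type*} [NormedAddCommGroup X] [NormedSpace ℝ X]

omit [NormedSpace ℝ X] in
/-- A function is bounded, locally uniformly in a parameter, on compact sets. -/
lemma eventually_forall_norm_le_of_continuous {P : Type*} [TopologicalSpace P]
    {H : P → ℝ → X} (hH : Continuous (Function.uncurry H)) {K : Set ℝ} (hK : IsCompact K) (x₀ : P) :
    ∃ C, 0 ≤ C ∧ ∀ᶠ x in 𝓝 x₀, ∀ s ∈ K, ‖H x s‖ ≤ C := by
  obtain ⟨C, hC⟩ := hK.exists_bound_of_continuousOn (f := H x₀)
    (by fun_prop : Continuous (H x₀)).continuousOn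
  obtain ⟨u, v, hu, -, hxu, hKv, huv⟩ := generalized_tube_lemma (isCompact_singleton (x := x₀)) hK
    (n := {p : P × ℝ | ‖Function.uncurry H p‖ < max C 0 + 1})
    (isOpen_lt (by fun_prop) (by fun_prop)) (by
      rintro ⟨x, s⟩ ⟨hx, hs⟩
      rw [mem_singleton_iff] at hx
      subst hx
      exact lt_of_le_of_lt (hC s hs) (lt_of_le_of_lt (le_max_left C 0) (lt_add_one _)))
  refine ⟨max C 0 + 1, by positivity, ?_⟩
  filter_upwards [hu.mem_nhds (hxu rfl)] with x hx s hs
  exact (huv (⟨hx, hKv hs⟩ : (x, s) ∈ u ×ˢ v) : ‖H x s‖ < _).le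

/-- Dominated convergence. The weight may be singular, like `g_β` at `0` for `β < 1`, but must not
depend on the parameter; `fracConv_eq` brings convolutions to this form. -/
lemma continuous_parametric_integral_smul {P : Type*} [TopologicalSpace P]
    [FirstCountableTopology P] {φ : ℝ → ℝ} (hφ : ∀ a b, IntervalIntegrable φ volume a b)
    {H : P → ℝ → X} (hH : Continuous (Function.uncurry H)) :
    Continuous fun p : P × ℝ => ∫ s in (0 : ℝ)..p.2, φ s • H p.1 s := by
  rw [continuous_iff_continuousAt]
  rintro ⟨x₀, b₀⟩
  have hHx : ∀ x, Continuous (H x) := fun x => by fun_prop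
  set a := min 0 b₀ - 1
  set b := max 0 b₀ + 1
  obtain ⟨C, -, hC⟩ := eventually_forall_norm_le_of_continuous hH (isCompact_uIcc (a := a) (b := b)) x₀
  refine intervalIntegral.continuousAt_parametric_primitive_of_dominated (F := fun x s => φ s • H x s)
    (fun s => |φ s| * C) a b (fun x => ?_) ?_ ?_ ?_ ?_ ?_ (by simp)
  · exact (hφ a b).aestronglyMeasurable_restrict_uIoc.smul (hHx x).aestronglyMeasurable
  · filter_upwards [hC] with x hx
    filter_upwards [ae_restrict_mem measurableSet_uIoc] with s hs
    rw [norm_smul, Real.norm_eq_abs]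
    gcongr
    exact hx s (uIoc_subset_uIcc hs)
  · exact (hφ a b).abs.mul_const C
  · refine Eventually.of_forall fun s => ?_
    have : Continuous fun x => H x s := hH.comp (Continuous.prodMk_left s)
    exact (continuous_const.smul this).continuousAt
  · exact ⟨by have := min_le_left 0 b₀; simp only [a]; linarith,
      by have := le_max_left 0 b₀; simp only [b]; linarith⟩
  · exact ⟨by have := min_le_right 0 b₀; simp only [a]; linarith,
      by have := le_max_right 0 b₀; simp only [b]; linarith⟩

/-- Fubini on the triangle `0 < τ ≤ s ≤ t`. Integrability with two singular weights comes from that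
of the convolution integrand of two `L¹` functions, multiplied by a bounded continuous factor. -/
lemma triangle_swap {φ ψ : ℝ → ℝ} (hφ : ∀ a b, IntervalIntegrable φ volume a b)
    (hψ : ∀ a b, IntervalIntegrable ψ volume a b) {W : ℝ → ℝ → X}
    (hW : Continuous (Function.uncurry W)) {t : ℝ} (ht : 0 ≤ t) :
    ∫ s in (0 : ℝ)..t, ∫ τ in (0 : ℝ)..s, (φ (t - s) * ψ (s - τ)) • W s τ =
      ∫ τ in (0 : ℝ)..t, ∫ σ in (0 : ℝ)..(t - τ), (φ (t - τ - σ) * ψ σ) • W (τ + σ) τ := by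
  set k : ℝ → ℝ := (Ioc 0 t).indicator fun s => φ (t - s) with hk
  -- The reflection makes `l (τ - s) = ψ (s - τ)`, the shape of a convolution integrand in the
  -- variable `τ`.
  set l : ℝ → ℝ := (Icc (-t) 0).indicator fun x => ψ (-x) with hl
  have hki : Integrable k := by
    rw [hk, integrable_indicator_iff measurableSet_Ioc, ← intervalIntegrable_iff_integrableOn_Ioc_of_le ht]
    have := (hφ (t - 0) (t - t)).comp_sub_left t
    simpa using this
  have hli : Integrable l := by
    rw [hl, integrable_indicator_iff measurableSet_Icc, integrableOn_Icc_iff_integrableOn_Ioc,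
      ← intervalIntegrable_iff_integrableOn_Ioc_of_le (by linarith)]
    have := (hψ (0 - -t) (0 - 0)).comp_sub_left 0
    simpa using this
  have hK : Integrable (fun p : ℝ × ℝ => k p.2 * l (p.1 - p.2)) (volume.prod volume) :=
    Integrable.convolution_integrand (ContinuousLinearMap.mul ℝ ℝ) hki hli
  set W' : ℝ × ℝ → X := fun p => W (projIcc 0 t ht p.2) (projIcc 0 t ht p.1)
  have hW'c : Continuous W' := by
    have h1 : Continuous fun p : ℝ × ℝ => (((projIcc 0 t ht p.2 : ℝ)), ((projIcc 0 t ht p.1 : ℝ))) := by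
      have := continuous_projIcc (h := ht)
      fun_prop
    exact hW.comp h1
  obtain ⟨C, hC⟩ := ((isCompact_Icc (a := (0:ℝ)) (b := t)).prod (isCompact_Icc (a := (0:ℝ)) (b := t))).exists_bound_of_continuousOn
    hW.continuousOn
  have hF : Integrable (fun p : ℝ × ℝ => (k p.2 * l (p.1 - p.2)) • W' p) (volume.prod volume) :=
    hK.smul_bdd C hW'c.aestronglyMeasurable (Eventually.of_forall fun p =>
      hC (_, _) ⟨(projIcc 0 t ht p.2).2, (projIcc 0 t ht p.1).2⟩)
  -- The supports of `k` and `l` enforce `0 < s ≤ t` and `τ ≤ s`; the indicator adds the missing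
  -- condition `0 < τ`.
  set F : ℝ → ℝ → X := fun τ s =>
    {p : ℝ × ℝ | 0 < p.1}.indicator (fun p : ℝ × ℝ => (k p.2 * l (p.1 - p.2)) • W' p) (τ, s) with hFdef
  have hF' : Integrable (Function.uncurry F) (volume.prod volume) :=
    hF.indicator (measurableSet_lt measurable_const measurable_fst)
  have hFval : ∀ τ s, 0 < τ → τ ≤ s → s ≤ t → F τ s = (φ (t - s) * ψ (s - τ)) • W s τ := by
    intro τ s h1 h2 h3
    have e1 : (projIcc 0 t ht s : ℝ) = s := by rw [projIcc_of_mem ht ⟨by linarith, h3⟩]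
    have e2 : (projIcc 0 t ht τ : ℝ) = τ := by rw [projIcc_of_mem ht ⟨by linarith, by linarith⟩]
    simp only [hFdef, W', hk, hl]
    rw [indicator_of_mem (by simpa using h1), indicator_of_mem (show s ∈ Ioc 0 t from ⟨by linarith, h3⟩),
      indicator_of_mem (show τ - s ∈ Icc (-t) 0 from ⟨by linarith, by linarith⟩), e1, e2, neg_sub]
  have hFzero : ∀ τ s, ¬ (0 < τ ∧ τ ≤ s ∧ s ≤ t) → F τ s = 0 := by
    intro τ s h
    by_cases h1 : 0 < τ
    · by_cases h2 : s ∈ Ioc 0 t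
      · have h3 : τ - s ∉ Icc (-t) 0 := fun h3 => h ⟨h1, by linarith [h3.2], h2.2⟩
        simp [hFdef, hl, h3]
      · simp [hFdef, hk, h2]
    · simp [hFdef, h1]
  have hswap := integral_integral_swap hF'
  have hL : ∫ s, ∫ τ, F τ s =
      ∫ s in (0 : ℝ)..t, ∫ τ in (0 : ℝ)..s, (φ (t - s) * ψ (s - τ)) • W s τ := by
    rw [intervalIntegral.integral_of_le ht, ← integral_indicator measurableSet_Ioc]
    congr 1 with s
    by_cases hs : s ∈ Ioc 0 t
    · rw [indicator_of_mem hs, intervalIntegral.integral_of_le hs.1.le,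
        ← integral_indicator measurableSet_Ioc]
      congr 1 with τ
      by_cases hτ : τ ∈ Ioc 0 s
      · rw [indicator_of_mem hτ, hFval τ s hτ.1 hτ.2 hs.2]
      · rw [indicator_of_notMem hτ, hFzero τ s fun h => hτ ⟨h.1, h.2.1⟩]
    · rw [indicator_of_notMem hs]
      have : ∀ τ, F τ s = 0 := fun τ => hFzero τ s fun h => hs ⟨by linarith, h.2.2⟩
      simp [this]
  have hR : ∫ τ, ∫ s, F τ s =
      ∫ τ in (0 : ℝ)..t, ∫ σ in (0 : ℝ)..(t - τ), (φ (t - τ - σ) * ψ σ) • W (τ + σ) τ := by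
    rw [intervalIntegral.integral_of_le ht, ← integral_indicator measurableSet_Ioc]
    congr 1 with τ
    by_cases hτ : τ ∈ Ioc 0 t
    · have := intervalIntegral.integral_comp_add_left (a := 0) (b := t - τ)
        (fun s => (φ (t - s) * ψ (s - τ)) • W s τ) τ
      simp only [add_sub_cancel_left, add_zero, add_sub_cancel, ← sub_sub] at this
      rw [indicator_of_mem hτ, this, intervalIntegral.integral_of_le hτ.2, ← integral_Icc_eq_integral_Ioc,
        ← integral_indicator measurableSet_Icc]
      congr 1 with s
      by_cases hs : s ∈ Icc τ t
      · rw [indicator_of_mem hs, hFval τ s hτ.1 hs.1 hs.2]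
      · rw [indicator_of_notMem hs, hFzero τ s fun h => hs ⟨h.2.1, h.2.2⟩]
    · rw [indicator_of_notMem hτ]
      have : ∀ s, F τ s = 0 := fun s => hFzero τ s fun h => hτ ⟨h.1, by linarith⟩
      simp [this]
  rw [← hL, ← hR, hswap]

lemma intervalIntegrable_fracKernel {β : ℝ} (hβ : 0 < β) (a b : ℝ) :
    IntervalIntegrable (fracKernel β) volume a b :=
  (intervalIntegral.intervalIntegrable_rpow' (by linarith)).div_const _

lemma intervalIntegrable_fracKernel_sub {β : ℝ} (hβ : 0 < β) (t a b : ℝ) :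
    IntervalIntegrable (fun s => fracKernel β (t - s)) volume a b := by
  simpa using (intervalIntegrable_fracKernel hβ (t - a) (t - b)).comp_sub_left t

lemma intervalIntegrable_fracKernel_smul {β : ℝ} (hβ : 0 < β) {f : ℝ → X} (hf : Continuous f)
    (t a b : ℝ) : IntervalIntegrable (fun s => fracKernel β (t - s) • f s) volume a b :=
  (intervalIntegrable_fracKernel_sub hβ t a b).smul_continuousOn hf.continuousOn

lemma fracKernel_one (t : ℝ) : fracKernel 1 t = 1 := by simp [fracKernel]

lemma fracConv_one (f : ℝ → X) (t : ℝ) : fracConv 1 f t = ∫ s in (0 : ℝ)..t, f s := by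
  simp [fracConv, fracKernel_one]

@[simp] lemma fracConv_zero_right (β : ℝ) (f : ℝ → X) : fracConv β f 0 = 0 := by simp [fracConv]

lemma fracConv_congr (β : ℝ) {f g : ℝ → X} {t : ℝ} (ht : 0 ≤ t) (h : EqOn f g (Icc 0 t)) :
    fracConv β f t = fracConv β g t := by
  refine intervalIntegral.integral_congr fun s hs => ?_
  rw [uIcc_of_le ht] at hs
  simp only [h hs]

lemma fracConv_eq (β : ℝ) (f : ℝ → X) (t : ℝ) :
    fracConv β f t = ∫ s in (0 : ℝ)..t, fracKernel β s • f (t - s) := by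
  have := intervalIntegral.integral_comp_sub_left (a := 0) (b := t)
    (fun s => fracKernel β s • f (t - s)) t
  simpa [fracConv] using this

lemma continuous_fracConv_param {P : Type*} [TopologicalSpace P] [FirstCountableTopology P]
    {β : ℝ} (hβ : 0 < β) {F : P → ℝ → X} (hF : Continuous (Function.uncurry F)) :
    Continuous fun p : P × ℝ => fracConv β (F p.1) p.2 := by
  simp only [fracConv_eq]
  have := continuous_parametric_integral_smul (P := P × ℝ) (φ := fracKernel β) (X := X)
    (intervalIntegrable_fracKernel hβ) (H := fun p s => F p.1 (p.2 - s))
    (hF.comp (by fun_prop : Continuous fun q : (P × ℝ) × ℝ => (q.1.1, q.1.2 - q.2)))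
  exact this.comp (by fun_prop : Continuous fun p : P × ℝ => (p, p.2))

lemma continuous_fracConv {β : ℝ} (hβ : 0 < β) {f : ℝ → X} (hf : Continuous f) :
    Continuous (fracConv β f) :=
  (continuous_fracConv_param (P := Unit) hβ (F := fun _ => f) (by fun_prop)).comp
    (Continuous.prodMk_right ())

lemma fracConv_add {β : ℝ} (hβ : 0 < β) {f g : ℝ → X} (hf : Continuous f) (hg : Continuous g)
    (t : ℝ) : fracConv β (fun s => f s + g s) t = fracConv β f t + fracConv β g t := by
  simp only [fracConv, smul_add]
  exact intervalIntegral.integral_add (intervalIntegrable_fracKernel_smul hβ hf _ _ _)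
    (intervalIntegrable_fracKernel_smul hβ hg _ _ _)

lemma fracConv_sub {β : ℝ} (hβ : 0 < β) {f g : ℝ → X} (hf : Continuous f) (hg : Continuous g)
    (t : ℝ) : fracConv β (fun s => f s - g s) t = fracConv β f t - fracConv β g t := by
  simp only [fracConv, smul_sub]
  exact intervalIntegral.integral_sub (intervalIntegrable_fracKernel_smul hβ hf _ _ _)
    (intervalIntegrable_fracKernel_smul hβ hg _ _ _)

lemma fracConv_smul (β c : ℝ) (f : ℝ → X) (t : ℝ) :
    fracConv β (fun s => c • f s) t = c • fracConv β f t := by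
  simp only [fracConv, smul_comm _ c]
  exact intervalIntegral.integral_smul c _

lemma hasDerivAt_fracConv_one [CompleteSpace X] {f : ℝ → X} (hf : Continuous f) (t : ℝ) :
    HasDerivAt (fracConv 1 f) (f t) t := by
  have : fracConv 1 f = fun t => ∫ s in (0 : ℝ)..t, f s := funext fun t => fracConv_one f t
  rw [this]
  exact intervalIntegral.integral_hasDerivAt_right (hf.intervalIntegrable _ _)
    hf.aestronglyMeasurable.stronglyMeasurableAtFilter hf.continuousAt

/-- The semigroup law `g_a * g_b = g_{a+b}`. -/
lemma integral_fracKernel_mul_fracKernel {a b : ℝ} (ha : 0 < a) (hb : 0 < b) {u : ℝ} (hu : 0 < u) :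
    ∫ s in (0 : ℝ)..u, fracKernel a (u - s) * fracKernel b s = fracKernel (a + b) u := by
  have h1 := Complex.betaIntegral_scaled (b : ℂ) (a : ℂ) hu
  have h2 : ∫ s in (0 : ℝ)..u, ((s : ℂ)) ^ ((b : ℂ) - 1) * ((u : ℂ) - s) ^ ((a : ℂ) - 1) =
      ((∫ s in (0 : ℝ)..u, s ^ (b - 1) * (u - s) ^ (a - 1) : ℝ) : ℂ) := by
    rw [← intervalIntegral.integral_ofReal]
    refine intervalIntegral.integral_congr fun s hs => ?_
    rw [uIcc_of_le hu.le] at hs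
    have h0 : 0 ≤ u - s := sub_nonneg.2 hs.2
    push_cast [Complex.ofReal_cpow hs.1, Complex.ofReal_cpow h0]
    rfl
  have h3 : ∫ s in (0 : ℝ)..u, s ^ (b - 1) * (u - s) ^ (a - 1) =
      u ^ (b + a - 1) * ProbabilityTheory.beta b a := by
    rw [ProbabilityTheory.beta_eq_betaIntegralReal b a hb ha]
    rw [h2] at h1
    have h4 := congrArg Complex.re h1
    rw [Complex.ofReal_re] at h4
    have : (u : ℂ) ^ ((b : ℂ) + a - 1) = ((u ^ (b + a - 1) : ℝ) : ℂ) := by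
      push_cast [Complex.ofReal_cpow hu.le]; rfl
    rw [h4, this, Complex.re_ofReal_mul]
  have h5 : ∀ s, fracKernel a (u - s) * fracKernel b s =
      (Real.Gamma a * Real.Gamma b)⁻¹ * (s ^ (b - 1) * (u - s) ^ (a - 1)) := by
    intro s; simp only [fracKernel]; field_simp
  simp only [h5]
  rw [intervalIntegral.integral_const_mul, h3, ProbabilityTheory.beta, fracKernel, add_comm b a]
  have := (Real.Gamma_pos_of_pos ha).ne'
  have := (Real.Gamma_pos_of_pos hb).ne'
  field_simp

lemma fracConv_fracConv [CompleteSpace X] {a b : ℝ} (ha : 0 < a) (hb : 0 < b) {f : ℝ → X}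
    (hf : Continuous f) {t : ℝ} (ht : 0 ≤ t) :
    fracConv a (fracConv b f) t = fracConv (a + b) f t := by
  have h1 := triangle_swap (intervalIntegrable_fracKernel ha) (intervalIntegrable_fracKernel hb)
    (W := fun _ τ => f τ) (by fun_prop) ht
  have h2 : fracConv a (fracConv b f) t = ∫ s in (0 : ℝ)..t, ∫ τ in (0 : ℝ)..s,
      (fracKernel a (t - s) * fracKernel b (s - τ)) • f τ := by
    simp only [fracConv, mul_smul, intervalIntegral.integral_smul]
  rw [h2, h1, fracConv]
  refine intervalIntegral.integral_congr_ae ?_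
  -- The Beta integral needs an interval of positive length, so the point `τ = t` is discarded.
  filter_upwards [compl_mem_ae_iff.2 (measure_singleton t)] with τ hτ hτ'
  rw [uIoc_of_le ht] at hτ'
  rw [intervalIntegral.integral_smul_const, integral_fracKernel_mul_fracKernel ha hb]
  exact sub_pos.2 (lt_of_le_of_ne hτ'.2 hτ)

/-- The convolution `(S * f)(t) = ∫₀ᵗ S(t - s) f(s) ds` of an operator family with a function. -/
noncomputable def opConv (S : ℝ → X →L[ℝ] X) (f : ℝ → X) (t : ℝ) : X :=
  ∫ s in (0 : ℝ)..t, S (t - s) (f s)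

lemma opConv_congr (S : ℝ → X →L[ℝ] X) {f g : ℝ → X} {t : ℝ} (ht : 0 ≤ t)
    (h : EqOn f g (Icc 0 t)) : opConv S f t = opConv S g t := by
  refine intervalIntegral.integral_congr fun s hs => ?_
  rw [uIcc_of_le ht] at hs
  simp only [h hs]

lemma opConv_eq (S : ℝ → X →L[ℝ] X) (f : ℝ → X) (t : ℝ) :
    opConv S f t = ∫ s in (0 : ℝ)..t, S s (f (t - s)) := by
  have := intervalIntegral.integral_comp_sub_left (a := 0) (b := t) (fun s => S s (f (t - s))) t
  simpa [opConv] using this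

section
variable {S : ℝ → X →L[ℝ] X} (hS : Continuous fun p : ℝ × X => S p.1 p.2)
include hS

lemma continuous_apply_comp {P : Type*} [TopologicalSpace P] {u : P → ℝ} {v : P → X}
    (hu : Continuous u) (hv : Continuous v) : Continuous fun p => S (u p) (v p) :=
  hS.comp (hu.prodMk hv)

lemma continuous_opConv_param {P : Type*} [TopologicalSpace P] [FirstCountableTopology P]
    {F : P → ℝ → X} (hF : Continuous (Function.uncurry F)) :
    Continuous fun p : P × ℝ => opConv S (F p.1) p.2 := by
  simp only [opConv_eq]
  have := continuous_parametric_integral_smul (P := P × ℝ) (φ := fun _ => 1) (X := X)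
    (fun a b => intervalIntegrable_const) (H := fun p s => S s (F p.1 (p.2 - s)))
    (continuous_apply_comp hS continuous_snd
      (hF.comp (by fun_prop : Continuous fun q : (P × ℝ) × ℝ => (q.1.1, q.1.2 - q.2))))
  simp only [one_smul] at this
  exact this.comp (by fun_prop : Continuous fun p : P × ℝ => (p, p.2))

lemma continuous_opConv {f : ℝ → X} (hf : Continuous f) : Continuous (opConv S f) :=
  (continuous_opConv_param (P := Unit) hS (F := fun _ => f) (by fun_prop)).comp
    (Continuous.prodMk_right ())

lemma intervalIntegrable_apply {f : ℝ → X} (hf : Continuous f) (t a b : ℝ) :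
    IntervalIntegrable (fun s => S (t - s) (f s)) volume a b :=
  (continuous_apply_comp hS (by fun_prop) hf).intervalIntegrable _ _

lemma opConv_add {f g : ℝ → X} (hf : Continuous f) (hg : Continuous g) (t : ℝ) :
    opConv S (fun s => f s + g s) t = opConv S f t + opConv S g t := by
  simp only [opConv, map_add]
  exact intervalIntegral.integral_add (intervalIntegrable_apply hS hf _ _ _)
    (intervalIntegrable_apply hS hg _ _ _)

lemma opConv_sub {f g : ℝ → X} (hf : Continuous f) (hg : Continuous g) (t : ℝ) :
    opConv S (fun s => f s - g s) t = opConv S f t - opConv S g t := by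
  simp only [opConv, map_sub]
  exact intervalIntegral.integral_sub (intervalIntegrable_apply hS hf _ _ _)
    (intervalIntegrable_apply hS hg _ _ _)

omit hS in
lemma opConv_smul (c : ℝ) (f : ℝ → X) (t : ℝ) :
    opConv S (fun s => c • f s) t = c • opConv S f t := by
  simp only [opConv, map_smul]
  exact intervalIntegral.integral_smul c _

/-- Fubini with weight `1` in place of the second kernel. For `a = α - 1` the right-hand side is
`P_α * f`. -/
lemma fracConv_opConv {a : ℝ} (ha : 0 < a) {f : ℝ → X} (hf : Continuous f) {t : ℝ} (ht : 0 ≤ t) :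
    fracConv a (opConv S f) t =
      ∫ τ in (0 : ℝ)..t, fracConv a (fun s => S s (f τ)) (t - τ) := by
  have h1 := triangle_swap (intervalIntegrable_fracKernel ha) (ψ := fun _ => 1)
    (fun a b => intervalIntegrable_const) (W := fun s τ => S (s - τ) (f τ))
    (continuous_apply_comp hS (by fun_prop) (by fun_prop)) ht
  simpa [fracConv, opConv] using h1

lemma opConv_fracConv [CompleteSpace X] {a : ℝ} (ha : 0 < a) {f : ℝ → X} (hf : Continuous f)
    {t : ℝ} (ht : 0 ≤ t) :
    opConv S (fracConv a f) t = fracConv a (opConv S f) t := by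
  rw [fracConv_opConv hS ha hf ht]
  have h1 := triangle_swap (φ := fun _ => 1) (fun a b => intervalIntegrable_const)
    (intervalIntegrable_fracKernel ha) (W := fun s τ => S (t - s) (f τ))
    (continuous_apply_comp hS (by fun_prop) (by fun_prop)) ht
  have h2 : opConv S (fracConv a f) t = ∫ s in (0 : ℝ)..t, ∫ τ in (0 : ℝ)..s,
      (1 * fracKernel a (s - τ)) • S (t - s) (f τ) := by
    refine intervalIntegral.integral_congr fun s _ => ?_
    simp only [fracConv, one_mul]
    rw [← ContinuousLinearMap.intervalIntegral_comp_comm _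
      (intervalIntegrable_fracKernel_smul ha hf _ _ _)]
    simp only [map_smul]
  rw [h2, h1]
  refine intervalIntegral.integral_congr fun τ _ => ?_
  simp only [fracConv_eq, one_mul, sub_sub]

end

end

/-! ### Closed graphs, the resolvent identity and variation of constants. -/

section

variable {X : Type u} [NormedAddCommGroup X] [NormedSpace ℝ X]

/-- Continuous functions with equal primitives on `[0,r]` agree there. -/
lemma eqOn_of_fracConv_one_eqOn [CompleteSpace X] {r : ℝ} (hr : 0 < r) {a b : ℝ → X}
    (ha : Continuous a) (hb : Continuous b)
    (h : EqOn (fracConv 1 a) (fracConv 1 b) (Icc 0 r)) : EqOn a b (Icc 0 r) := fun t ht =>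
  UniqueDiffWithinAt.eq_deriv (Icc 0 r) (uniqueDiffOn_Icc hr t ht) (hasDerivAt_fracConv_one ha t).hasDerivWithinAt
    ((hasDerivAt_fracConv_one hb t).hasDerivWithinAt.congr h (h ht))

lemma fracConv_eq_add_primitive [CompleteSpace X] {β : ℝ} (hβ : 1 < β) {f : ℝ → X}
    (hf : Continuous f) {t : ℝ} (ht : 0 ≤ t) :
    fracConv 1 (fracConv (β - 1) f) t = fracConv β f t := by
  rw [fracConv_fracConv one_pos (by linarith) hf ht]; congr 1; ring

section
variable {G : Submodule ℝ (X × X)} (hG : IsClosed (G : Set (X × X)))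
include hG

/-- A closed subspace of a product is the kernel of a continuous linear map. -/
lemma exists_ker_eq_of_isClosed [CompleteSpace X] :
    ∃ (Q : Type u) (_ : NormedAddCommGroup Q) (_ : NormedSpace ℝ Q)
    (q : X × X →L[ℝ] Q), CompleteSpace Q ∧ ∀ p, p ∈ G ↔ q p = 0 := by
  have : IsClosed (G : Set (X × X)) := hG
  exact ⟨(X × X) ⧸ G, inferInstance, inferInstance, G.mkQL, inferInstance, fun p =>
    (Submodule.Quotient.mk_eq_zero G).symm⟩

variable [CompleteSpace X]

/-- A closed operator passes through integrals: the quotient map with kernel `G` commutes with the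
integral and kills the integrand. -/
lemma intervalIntegral_mem {a b : ℝ → X} {l u : ℝ} (hlu : l ≤ u)
    (ha : IntervalIntegrable a volume l u) (hb : IntervalIntegrable b volume l u)
    (h : ∀ s ∈ Icc l u, (a s, b s) ∈ G) :
    (∫ s in l..u, a s, ∫ s in l..u, b s) ∈ G := by
  obtain ⟨Q, _, _, q, _, hq⟩ := exists_ker_eq_of_isClosed hG
  simp only [intervalIntegral.integral_of_le hlu]
  have e : (∫ s in Ioc l u, a s, ∫ s in Ioc l u, b s) = ∫ s in Ioc l u, (a s, b s) :=
    (integral_pair ha.1 hb.1).symm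
  rw [e, hq, ← ContinuousLinearMap.integral_comp_comm q (ha.1.prodMk hb.1)]
  exact setIntegral_eq_zero_of_forall_eq_zero fun s hs => (hq _).1 (h s (Ioc_subset_Icc_self hs))

lemma fracConv_mem {β : ℝ} (hβ : 0 < β) {a b : ℝ → X} (ha : Continuous a) (hb : Continuous b)
    {t : ℝ} (ht : 0 ≤ t) (h : ∀ s ∈ Icc 0 t, (a s, b s) ∈ G) :
    (fracConv β a t, fracConv β b t) ∈ G :=
  intervalIntegral_mem hG ht (intervalIntegrable_fracKernel_smul hβ ha _ _ _)
    (intervalIntegrable_fracKernel_smul hβ hb _ _ _) fun s hs => G.smul_mem _ (h s hs)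

/-- A closed operator passes through derivatives: the image of `(a, b)` in the quotient by `G` has
zero primitive. -/
lemma mem_of_fracConv_one_mem {r : ℝ} (hr : 0 < r) {a b : ℝ → X} (ha : Continuous a)
    (hb : Continuous b) (h : ∀ t ∈ Icc 0 r, (fracConv 1 a t, fracConv 1 b t) ∈ G) :
    ∀ t ∈ Icc 0 r, (a t, b t) ∈ G := by
  obtain ⟨Q, _, _, q, _, hq⟩ := exists_ker_eq_of_isClosed hG
  intro t ht
  rw [hq]
  have hab := ha.prodMk hb
  refine eqOn_of_fracConv_one_eqOn hr (a := fun s => q (a s, b s)) (b := fun _ => 0)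
    (q.continuous.comp hab) continuous_const (fun s hs => ?_) ht
  have h1 := (hq _).1 (h s hs)
  simp only [fracConv_one, intervalIntegral.integral_zero]
  rw [q.intervalIntegral_comp_comm (hab.intervalIntegrable _ _), ← h1]
  congr 1
  simp only [fracConv_one, intervalIntegral.integral_of_le hs.1]
  exact integral_pair (ha.intervalIntegrable _ _).1 (hb.intervalIntegrable _ _).1

end

/-- A strongly continuous family `S` of operators which on `[0,r]` satisfies the `α`-times
resolvent equation for the closed densely defined operator with graph `G`. -/
structure IsResolventOn (α r : ℝ) (G : Submodule ℝ (X × X)) (S : ℝ → X →L[ℝ] X) : Prop where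
  isClosed : IsClosed (G : Set (X × X))
  dense : Dense {x : X | ∃ y, (x, y) ∈ G}
  functional : ∀ y, ((0 : X), y) ∈ G → y = 0
  continuous : Continuous fun p : ℝ × X => S p.1 p.2
  map_zero : ∀ z, S 0 z = z
  commutes : ∀ t ∈ Icc 0 r, ∀ x y, (x, y) ∈ G → (S t x, S t y) ∈ G
  resolvent_eq : ∀ t ∈ Icc 0 r, ∀ x y, (x, y) ∈ G → S t x = x + fracConv α (fun s => S s y) t

namespace IsResolventOn

variable {α r : ℝ} {G : Submodule ℝ (X × X)} {S : ℝ → X →L[ℝ] X} (h : IsResolventOn α r G S)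
include h

lemma eq_of_mem {x y z : X} (h1 : (x, y) ∈ G) (h2 : (x, z) ∈ G) : y = z := by
  have := G.sub_mem h1 h2
  rw [Prod.mk_sub_mk, sub_self] at this
  exact sub_eq_zero.1 (h.functional _ this)

lemma continuous_apply (z : X) : Continuous fun s => S s z :=
  continuous_apply_comp h.continuous continuous_id continuous_const

variable [CompleteSpace X]

/-- For `z` in the domain this is the resolvent equation with `A` taken out of the integral. Both
components depend continuously on `z`, so density and closedness give all `z`. -/
lemma fracConv_apply_mem (hα : 0 < α) (z : X) {t : ℝ} (ht : t ∈ Icc 0 r) :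
    (fracConv α (fun s => S s z) t, S t z - z) ∈ G := by
  have hc : IsClosed {z : X | (fracConv α (fun s => S s z) t, S t z - z) ∈ G} := by
    refine h.isClosed.preimage (Continuous.prodMk ?_ (by fun_prop))
    exact (continuous_fracConv_param (P := X) hα (F := fun z s => S s z)
      (continuous_apply_comp h.continuous continuous_snd continuous_fst)).comp
      (Continuous.prodMk_left t)
  refine hc.closure_subset_iff.2 ?_ (h.dense z)
  rintro x ⟨y, hxy⟩
  have e : S t x - x = fracConv α (fun s => S s y) t := by
    rw [h.resolvent_eq t ht x y hxy, add_sub_cancel_left]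
  rw [mem_ofPred_eq, e]
  exact fracConv_mem h.isClosed hα (h.continuous_apply x) (h.continuous_apply y) ht.1
    fun s hs => h.commutes s ⟨hs.1, hs.2.trans ht.2⟩ x y hxy

/-- Integrates `fracConv_apply_mem` along `z = f(τ)`. This identity drives both directions of the
theorem, since it needs no smoothness of `f`. -/
lemma fracConv_opConv_mem (hα : 0 < α) {f : ℝ → X} (hf : Continuous f) {t : ℝ}
    (ht : t ∈ Icc 0 r) :
    (fracConv α (opConv S f) t, opConv S f t - fracConv 1 f t) ∈ G := by
  have e : opConv S f t - fracConv 1 f t = ∫ s in (0 : ℝ)..t, (S (t - s) (f s) - f s) := by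
    rw [opConv, fracConv_one, intervalIntegral.integral_sub
      (intervalIntegrable_apply h.continuous hf _ _ _) (hf.intervalIntegrable _ _)]
  rw [e, fracConv_opConv h.continuous hα hf ht.1]
  have hc : Continuous fun τ => fracConv α (fun s => S s (f τ)) (t - τ) :=
    (continuous_fracConv_param (P := ℝ) hα (F := fun τ s => S s (f τ))
      (continuous_apply_comp h.continuous continuous_snd (hf.comp continuous_fst))).comp
      (by fun_prop : Continuous fun τ : ℝ => (τ, t - τ))
  refine intervalIntegral_mem h.isClosed ht.1 (hc.intervalIntegrable _ _)
    ((intervalIntegrable_apply h.continuous hf _ _ _).sub (hf.intervalIntegrable _ _))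
    fun s hs => h.fracConv_apply_mem hα _ ⟨sub_nonneg.2 hs.2, by linarith [hs.1, ht.2]⟩

lemma opConv_mem {a b : ℝ → X} (ha : Continuous a) (hb : Continuous b) {t : ℝ} (ht : t ∈ Icc 0 r)
    (hab : ∀ s ∈ Icc 0 t, (a s, b s) ∈ G) : (opConv S a t, opConv S b t) ∈ G :=
  intervalIntegral_mem h.isClosed ht.1 (intervalIntegrable_apply h.continuous ha _ _ _)
    (intervalIntegrable_apply h.continuous hb _ _ _) fun s hs =>
      h.commutes _ ⟨sub_nonneg.2 hs.2, by linarith [hs.1, ht.2]⟩ _ _ (hab s hs)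

/-- The variation of constants formula for the integrated problem `u = g_α * (A u + f)`. -/
lemma eq_fracConv_opConv (hα : 1 < α) (hr : 0 < r) {f u w : ℝ → X} (hf : Continuous f)
    (hu : Continuous u) (hw : Continuous w) (huw : ∀ t ∈ Icc 0 r, (u t, w t) ∈ G)
    (heq : ∀ t ∈ Icc 0 r, u t = fracConv α (fun s => w s + f s) t) :
    EqOn u (fracConv (α - 1) (opConv S f)) (Icc 0 r) := by
  have hS := h.continuous
  have hα0 : 0 < α := by linarith
  have hVf := continuous_opConv hS hf
  have hVw := continuous_opConv hS hw
  refine eqOn_of_fracConv_one_eqOn hr hu (continuous_fracConv (by linarith) hVf) fun t ht => ?_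
  have hsub : ∀ s ∈ Icc 0 t, s ∈ Icc 0 r := fun s hs => ⟨hs.1, hs.2.trans ht.2⟩
  -- `A(g_α * S * u)` is computed twice: as `S * u - 1 * u`, and as `g_α * S * w` because `S`
  -- commutes with `A`. Since `S * u = g_α * S * w + g_α * S * f`, what remains is `1 * u = g_α * S
  -- * f`.
  have h1 := h.fracConv_opConv_mem hα0 hu ht
  have h2 : (fracConv α (opConv S u) t, fracConv α (opConv S w) t) ∈ G :=
    fracConv_mem h.isClosed hα0 (continuous_opConv hS hu) hVw ht.1 fun s hs =>
      h.opConv_mem hu hw (hsub s hs) fun σ hσ => huw σ (hsub σ ⟨hσ.1, hσ.2.trans hs.2⟩)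
  have h3 := h.eq_of_mem h1 h2
  have h4 : opConv S u t = fracConv α (opConv S w) t + fracConv α (opConv S f) t := by
    rw [opConv_congr S ht.1 fun s hs => heq s (hsub s hs),
      opConv_fracConv hS hα0 (f := fun s => w s + f s) (by fun_prop) ht.1, ← fracConv_add hα0 hVw hVf]
    exact fracConv_congr α ht.1 fun s _ => opConv_add hS hw hf s
  rw [fracConv_eq_add_primitive hα hVf ht.1]
  rw [h4, add_sub_assoc, add_eq_left, sub_eq_zero] at h3
  exact h3.symm

end IsResolventOn

end

/-! ### Bounded semivariation makes `S * f` continuously differentiable. -/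

section

variable {X : Type u} [NormedAddCommGroup X] [NormedSpace ℝ X]

/-- `B` bounds the semivariation of `S` on `[0,r]`. -/
def SemivariationLE (r : ℝ) (S : ℝ → X →L[ℝ] X) (B : ℝ) : Prop :=
  ∀ (p : Subdivision 0 r) (x : Fin p.n → X), (∀ i, ‖x i‖ ≤ 1) →
    ‖∑ i : Fin p.n, (S (p.d i.succ) (x i) - S (p.d i.castSucc) (x i))‖ ≤ B

lemma SemivariationLE.nonneg {r : ℝ} {S : ℝ → X →L[ℝ] X} {B : ℝ} (hr : 0 < r)
    (hB : SemivariationLE r S B) : 0 ≤ B := by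
  have := hB ⟨1, fun i => i * r, fun i j hij => by
    have : ((i : ℕ) : ℝ) < (j : ℕ) := by exact_mod_cast hij
    exact mul_lt_mul_of_pos_right this hr, by simp, by simp⟩ (fun _ => 0) (by simp)
  simpa using this

/-- The bound on the semivariation, for subdivisions of a smaller interval `[0,t]`. -/
lemma SemivariationLE.norm_sum_le {r : ℝ} {S : ℝ → X →L[ℝ] X} {B : ℝ}
    (hB : SemivariationLE r S B) {d : ℕ → ℝ} (hd : StrictMono d) (hd0 : d 0 = 0) {n : ℕ}
    (hn : d n < r) {y : ℕ → X} {M : ℝ} (hM : 0 < M) (hy : ∀ i < n, ‖y i‖ ≤ M) :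
    ‖∑ i ∈ Finset.range n, (S (d (i + 1)) (y i) - S (d i) (y i))‖ ≤ B * M := by
  -- The points are completed to a subdivision of `[0,r]` by adding `r`, with the vector `0` on the
  -- extra interval; `d n < r` keeps it strict.
  set d' : ℕ → ℝ := fun i => if i ≤ n then d i else r with hd'
  set x : ℕ → X := fun i => if i < n then M⁻¹ • y i else 0 with hx
  have hmono : StrictMono fun i : Fin (n + 1 + 1) => d' i := by
    intro i j hij
    have hij' : (i : ℕ) < j := hij
    have hi : (i : ℕ) ≤ n := by omega
    simp only [hd', hi, if_true]
    split_ifs with hj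
    · exact hd hij'
    · exact (hd.monotone hi).trans_lt hn
  have key := hB ⟨n + 1, fun i => d' i, hmono, by simp [hd', hd0], by simp [hd']⟩ (fun i => x i) (by
    intro i
    simp only [hx]
    split_ifs with hi
    · rw [norm_smul, norm_inv, Real.norm_of_nonneg hM.le, inv_mul_le_one₀ hM]
      exact hy _ hi
    · simp)
  have e : ∑ i : Fin (n + 1), (S (d' (i.succ : Fin (n + 1 + 1))) (x i) -
      S (d' (i.castSucc : Fin (n + 1 + 1))) (x i)) =
      M⁻¹ • ∑ i ∈ Finset.range n, (S (d (i + 1)) (y i) - S (d i) (y i)) := by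
    simp only [Fin.val_succ, Fin.val_castSucc]
    rw [Fin.sum_univ_eq_sum_range (fun i => S (d' (i + 1)) (x i) - S (d' i) (x i)),
      Finset.sum_range_succ, Finset.smul_sum]
    have : x n = 0 := by simp [hx]
    rw [this, map_zero, map_zero, sub_zero, add_zero]
    refine Finset.sum_congr rfl fun i hi => ?_
    have hi' := Finset.mem_range.1 hi
    simp [hx, hd', hi', hi'.le, Nat.succ_le_of_lt hi', smul_sub]
  have key' : ‖∑ i : Fin (n + 1), (S (d' (i.succ : Fin (n + 1 + 1))) (x i) -
      S (d' (i.castSucc : Fin (n + 1 + 1))) (x i))‖ ≤ B := key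
  rw [e, norm_smul, norm_inv, Real.norm_of_nonneg hM.le, inv_mul_le_iff₀ hM] at key'
  linarith

variable [CompleteSpace X]

lemma eq_add_fracConv_one {f f' : ℝ → X} (hf : ∀ t, HasDerivAt f (f' t) t) (hf' : Continuous f')
    (t : ℝ) : f t = f 0 + fracConv 1 f' t := by
  rw [fracConv_one, intervalIntegral.integral_eq_sub_of_hasDerivAt (fun s _ => hf s)
    (hf'.intervalIntegrable _ _), add_sub_cancel]

section
variable {S : ℝ → X →L[ℝ] X} (hS : Continuous fun p : ℝ × X => S p.1 p.2)
include hS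

omit [CompleteSpace X] in
lemma continuous_apply_add_opConv (z : X) {f' : ℝ → X} (hf' : Continuous f') :
    Continuous fun t => S t z + opConv S f' t :=
  (continuous_apply_comp hS continuous_id continuous_const).add (continuous_opConv hS hf')

/-- `S * f` is a primitive of `S f(0) + S * f'`. -/
lemma opConv_eq_fracConv_one {f f' : ℝ → X} (hf : ∀ t, HasDerivAt f (f' t) t)
    (hf' : Continuous f') {t : ℝ} (ht : 0 ≤ t) :
    opConv S f t = fracConv 1 (fun t => S t (f 0) + opConv S f' t) t := by
  have h1 : opConv S f t = opConv S (fun s => f 0 + fracConv 1 f' s) t :=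
    opConv_congr S ht fun s _ => eq_add_fracConv_one hf hf' s
  rw [h1, opConv_add hS continuous_const (continuous_fracConv one_pos hf'),
    opConv_fracConv hS one_pos hf' ht,
    fracConv_add one_pos (f := fun s => S s (f 0))
      (continuous_apply_comp hS continuous_id continuous_const)
      (continuous_opConv hS hf'), opConv_eq, fracConv_one, fracConv_one]

/-- The Riemann sums `∑ S(dᵢ) ∫ h` over uniform subdivisions approximate `∫ S h`. -/
lemma exists_norm_sum_sub_integral_le {h : ℝ → X} (hh : Continuous h) {t : ℝ} (ht : 0 < t) {ε : ℝ}
    (hε : 0 < ε) : ∃ n : ℕ, 0 < n ∧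
    ‖∑ i ∈ Finset.range n, S (i * (t / n)) (∫ s in (i * (t / n))..((i + 1 : ℕ) * (t / n)), h s) -
      ∫ s in (0 : ℝ)..t, S s (h s)‖ ≤ ε := by
  have hc : Continuous fun p : ℝ × ℝ => S p.1 (h p.2) :=
    continuous_apply_comp hS continuous_fst (hh.comp continuous_snd)
  -- Freezing the operator at `dᵢ` moves only the first variable of `(p, q) ↦ S(p) h(q)`. The
  -- tolerance `ε / t`, integrated over length `t`, gives `ε`.
  obtain ⟨δ, hδ, hδ'⟩ := Metric.uniformContinuousOn_iff.1
    ((((isCompact_Icc (a := (0 : ℝ)) (b := t)).prod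
      (isCompact_Icc (a := (0 : ℝ)) (b := t)))).uniformContinuousOn_of_continuous hc.continuousOn)
    (ε / t) (by positivity)
  obtain ⟨n, hn⟩ := exists_nat_gt (t / δ)
  have hn0 : (0 : ℝ) < n := lt_of_le_of_lt (by positivity) hn
  have htn : t / n < δ := by rw [div_lt_comm₀ hn0 hδ]; exact hn
  refine ⟨n, by exact_mod_cast hn0, ?_⟩
  have hd0 : 0 < t / n := by positivity
  have hi : Continuous fun s => S s (h s) := continuous_apply_comp hS continuous_id hh
  have e := intervalIntegral.sum_integral_adjacent_intervals (f := fun s => S s (h s))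
    (μ := volume) (a := fun i : ℕ => (i : ℝ) * (t / n)) (n := n)
    (fun k _ => hi.intervalIntegrable _ _)
  have e2 : (n : ℝ) * (t / n) = t := by field_simp
  simp only [Nat.cast_zero, zero_mul, e2] at e
  rw [← e, ← Finset.sum_sub_distrib]
  have hb : ∀ i ∈ Finset.range n,
      ‖S (i * (t / n)) (∫ s in (i * (t / n))..((i + 1 : ℕ) * (t / n)), h s) -
        ∫ s in (i * (t / n))..((i + 1 : ℕ) * (t / n)), S s (h s)‖ ≤ ε / t * (t / n) := by
    intro i hin
    have hin' : ((i : ℝ) + 1) ≤ n := by exact_mod_cast Finset.mem_range.1 hin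
    have hlt : ((i : ℝ) + 1) * (t / n) ≤ t := by
      calc ((i : ℝ) + 1) * (t / n) ≤ n * (t / n) := by gcongr
        _ = t := e2
    have h0 : 0 ≤ (i : ℝ) * (t / n) := by positivity
    rw [← ContinuousLinearMap.intervalIntegral_comp_comm _ (hh.intervalIntegrable _ _),
      ← intervalIntegral.integral_sub]
    · have := intervalIntegral.norm_integral_le_of_norm_le_const (a := (i : ℝ) * (t / n))
        (b := ((i + 1 : ℕ) : ℝ) * (t / n)) (C := ε / t)
        (f := fun s => S (i * (t / n)) (h s) - S s (h s)) ?_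
      · refine this.trans_eq ?_
        have e3 : ((i + 1 : ℕ) : ℝ) * (t / n) - i * (t / n) = t / n := by push_cast; ring
        rw [e3, abs_of_pos hd0]
      · intro s hs
        push_cast at hs
        rw [uIoc_of_le (by linarith)] at hs
        rw [← dist_eq_norm]
        refine (hδ' (_, s) ⟨⟨h0, by linarith⟩, ⟨by linarith [hs.1], by linarith [hs.2]⟩⟩ (s, s)
          ⟨⟨by linarith [hs.1], by linarith [hs.2]⟩, ⟨by linarith [hs.1], by linarith [hs.2]⟩⟩ ?_).le
        rw [Prod.dist_eq, dist_self, max_eq_left dist_nonneg, Real.dist_eq, abs_sub_comm,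
          abs_of_nonneg (sub_nonneg.2 hs.1.le)]
        linarith [hs.2]
    · exact (continuous_apply_comp hS continuous_const hh).intervalIntegrable _ _
    · exact hi.intervalIntegrable _ _
  have hfin := norm_sum_le_of_le (Finset.range n) hb
  refine hfin.trans_eq ?_
  rw [Finset.sum_const, Finset.card_range, nsmul_eq_mul]
  field_simp

/-- The operator `f ↦ (S * f)' - f` is bounded by the semivariation of `S`. -/
lemma norm_apply_add_opConv_sub_le {r B : ℝ} (hr : 0 < r) (hS0 : ∀ z, S 0 z = z)
    (hB : SemivariationLE r S B) {f f' : ℝ → X}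
    (hf : ∀ t, HasDerivAt f (f' t) t) (hf' : Continuous f') {M : ℝ} (hM : 0 < M)
    (hfM : ∀ s ∈ Icc 0 r, ‖f s‖ ≤ M) {t : ℝ} (ht : t ∈ Icc 0 r) :
    ‖S t (f 0) + opConv S f' t - f t‖ ≤ B * M := by
  have hfc : Continuous f := continuous_iff_continuousAt.2 fun t => (hf t).continuousAt
  have hcl : IsClosed {t | ‖S t (f 0) + opConv S f' t - f t‖ ≤ B * M} :=
    isClosed_le ((continuous_apply_add_opConv hS _ hf').sub hfc).norm continuous_const
  -- The Riemann sums need `t > 0` and `norm_sum_le` needs `t < r`; the end points follow by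
  -- continuity.
  suffices Ioo 0 r ⊆ {t | ‖S t (f 0) + opConv S f' t - f t‖ ≤ B * M} by
    have h2 := hcl.closure_subset_iff.2 this
    rw [closure_Ioo hr.ne] at h2
    exact h2 ht
  intro t ht
  change ‖S t (f 0) + opConv S f' t - f t‖ ≤ B * M
  refine le_of_forall_pos_le_add fun ε hε => ?_
  obtain ⟨n, hn, hsum⟩ := exists_norm_sum_sub_integral_le hS (h := fun s => f' (t - s))
    (by fun_prop) ht.1 hε
  have hn0 : (0 : ℝ) < n := by exact_mod_cast hn
  have hd0 : 0 < t / n := div_pos ht.1 hn0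
  set d : ℕ → ℝ := fun i => i * (t / n) with hd
  have hdn : d n = t := by simp only [hd]; field_simp
  have hdm : StrictMono d := fun i j hij => by
    have : (i : ℝ) < j := by exact_mod_cast hij
    exact mul_lt_mul_of_pos_right this hd0
  have hint : ∀ a b : ℝ, ∫ s in a..b, f' (t - s) = f (t - a) - f (t - b) := by
    intro a b
    rw [intervalIntegral.integral_comp_sub_left (fun s => f' s),
      intervalIntegral.integral_eq_sub_of_hasDerivAt (fun s _ => hf s)
        (hf'.intervalIntegrable _ _)]
  have hsum' : ‖∑ i ∈ Finset.range n, S (d i) (f (t - d i) - f (t - d (i + 1))) -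
      opConv S f' t‖ ≤ ε := by
    simp only [hint] at hsum
    rw [opConv_eq]
    exact hsum
  -- Abel summation moves the differences from `f` to `S`; the boundary terms are `S(t) f(0)` and
  -- `S(0) f(t) = f(t)`.
  have habel : S t (f 0) - f t + ∑ i ∈ Finset.range n, S (d i) (f (t - d i) - f (t - d (i + 1))) =
      ∑ i ∈ Finset.range n, (S (d (i + 1)) (f (t - d (i + 1))) - S (d i) (f (t - d (i + 1)))) := by
    have h1 := Finset.sum_range_sub (fun i => S (d i) (f (t - d i))) n
    have h2 : d 0 = 0 := by simp [hd]
    rw [hdn, h2, sub_self, sub_zero, hS0] at h1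
    rw [← h1, ← Finset.sum_add_distrib]
    refine Finset.sum_congr rfl fun i _ => ?_
    rw [map_sub]; abel
  have hbd := hB.norm_sum_le hdm (by simp [hd]) (n := n) (by rw [hdn]; exact ht.2)
    (y := fun i => f (t - d (i + 1))) hM (fun i hi => hfM _ ⟨?_, ?_⟩)
  · rw [← habel] at hbd
    have e : S t (f 0) + opConv S f' t - f t =
        (S t (f 0) - f t + ∑ i ∈ Finset.range n, S (d i) (f (t - d i) - f (t - d (i + 1)))) -
        (∑ i ∈ Finset.range n, S (d i) (f (t - d i) - f (t - d (i + 1))) - opConv S f' t) := by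
      abel
    rw [e]
    exact (norm_sub_le _ _).trans (add_le_add hbd hsum')
  · rw [sub_nonneg, ← hdn]
    exact hdm.monotone hi
  · have : 0 ≤ d (i + 1) := by simp only [hd]; positivity
    linarith [ht.2]

end

/-- A continuous function is approximated by its averages, uniformly on `[0,r]`. -/
lemma exists_hasDerivAt_norm_sub_le {f : ℝ → X} (hf : Continuous f) (r : ℝ) {ε : ℝ} (hε : 0 < ε) :
    ∃ g g' : ℝ → X, (∀ t, HasDerivAt g (g' t) t) ∧ Continuous g' ∧
      ∀ t ∈ Icc 0 r, ‖g t - f t‖ ≤ ε := by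
  obtain ⟨δ, hδ, hδ'⟩ := Metric.uniformContinuousOn_iff.1
    ((isCompact_Icc (a := (0 : ℝ)) (b := r + 1)).uniformContinuousOn_of_continuous hf.continuousOn)
    ε hε
  -- The bound `h ≤ 1` keeps the averaging window `[t, t + h]` inside `[0, r + 1]`, where `f` is
  -- uniformly continuous.
  set h := min (δ / 2) 1 with hh
  have h0 : 0 < h := by positivity
  have h1 : h ≤ 1 := min_le_right _ _
  have h2 : h < δ := (min_le_left _ _).trans_lt (by linarith)
  refine ⟨fun t => h⁻¹ • (fracConv 1 f (t + h) - fracConv 1 f t), fun t => h⁻¹ • (f (t + h) - f t),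
    fun t => ?_, by fun_prop, fun t ht => ?_⟩
  · exact (((hasDerivAt_fracConv_one hf (t + h)).comp_add_const t h).sub
      (hasDerivAt_fracConv_one hf t)).const_smul h⁻¹
  · have e : h⁻¹ • (fracConv 1 f (t + h) - fracConv 1 f t) - f t =
        h⁻¹ • ∫ s in t..(t + h), (f s - f t) := by
      rw [fracConv_one, fracConv_one, intervalIntegral.integral_interval_sub_left
        (hf.intervalIntegrable _ _) (hf.intervalIntegrable _ _), intervalIntegral.integral_sub
        (hf.intervalIntegrable _ _) intervalIntegrable_const, intervalIntegral.integral_const,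
        add_sub_cancel_left, smul_sub, inv_smul_smul₀ h0.ne']
    rw [e, norm_smul, norm_inv, Real.norm_of_nonneg h0.le, inv_mul_le_iff₀ h0]
    have := intervalIntegral.norm_integral_le_of_norm_le_const (a := t) (b := t + h) (C := ε)
      (f := fun s => f s - f t) ?_
    · rwa [add_sub_cancel_left, abs_of_pos h0, mul_comm] at this
    · intro s hs
      rw [uIoc_of_le (by linarith)] at hs
      rw [← dist_eq_norm]
      refine (hδ' s ⟨by linarith [hs.1, ht.1], by linarith [hs.2, ht.2]⟩ t
        ⟨ht.1, by linarith [ht.2]⟩ ?_).le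
      rw [Real.dist_eq, abs_of_pos (by linarith [hs.1])]
      linarith [hs.2]

section
variable {r : ℝ} (hr : 0 ≤ r)

omit [NormedSpace ℝ X] [CompleteSpace X] in
lemma continuous_IccExtend_uncurry :
    Continuous (Function.uncurry fun (g : C(Icc (0 : ℝ) r, X)) => IccExtend hr g) := by
  have : Continuous fun p : C(Icc (0 : ℝ) r, X) × ℝ => p.1 (projIcc 0 r hr p.2) := by
    have := continuous_projIcc (h := hr)
    fun_prop
  exact this

end

/-- If `S` has bounded semivariation, then `S * f` is continuously differentiable. -/
lemma exists_opConv_eq_fracConv_one {S : ℝ → X →L[ℝ] X}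
    (hS : Continuous fun p : ℝ × X => S p.1 p.2) (hS0 : ∀ z, S 0 z = z) {r B : ℝ} (hr : 0 < r)
    (hB : SemivariationLE r S B) {f : ℝ → X} (hf : Continuous f) :
    ∃ k : ℝ → X, Continuous k ∧ EqOn (opConv S f) (fracConv 1 k) (Icc 0 r) := by
  have hB0 := hB.nonneg hr
  choose g g' hg hg' hgf using fun n : ℕ =>
    exists_hasDerivAt_norm_sub_le hf r (ε := 1 / ((n : ℝ) + 1)) (by positivity)
  have hgc : ∀ n, Continuous (g n) := fun n =>
    continuous_iff_continuousAt.2 fun t => (hg n t).continuousAt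
  set k : ℕ → ℝ → X := fun n t => S t (g n 0) + opConv S (g' n) t with hk
  have hkc : ∀ n, Continuous (k n) := fun n => continuous_apply_add_opConv hS _ (hg' n)
  -- The semivariation controls `(S * g)' - g` for `g = g n - g m`; restoring `g` turns `B` into `B
  -- + 1`. Hence the derivatives `k n` are uniformly Cauchy.
  have hdiff : ∀ n m, ∀ t ∈ Icc 0 r,
      ‖k n t - k m t‖ ≤ (B + 1) * (1 / ((n : ℝ) + 1) + 1 / ((m : ℝ) + 1)) := by
    intro n m t ht
    have hM : ∀ s ∈ Icc 0 r, ‖g n s - g m s‖ ≤ 1 / ((n : ℝ) + 1) + 1 / ((m : ℝ) + 1) := by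
      intro s hs
      have : g n s - g m s = (g n s - f s) - (g m s - f s) := by abel
      rw [this]
      exact (norm_sub_le _ _).trans (add_le_add (hgf n s hs) (hgf m s hs))
    have h1 := norm_apply_add_opConv_sub_le hS hr hS0 hB (fun t => (hg n t).sub (hg m t))
      ((hg' n).sub (hg' m)) (M := 1 / ((n : ℝ) + 1) + 1 / ((m : ℝ) + 1)) (by positivity) hM ht
    have e : k n t - k m t = (S t (g n 0 - g m 0) + opConv S (fun s => g' n s - g' m s) t -
        (g n t - g m t)) + (g n t - g m t) := by
      rw [opConv_sub hS (hg' n) (hg' m), map_sub]; simp only [hk]; abel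
    rw [e, add_mul, one_mul]
    exact (norm_add_le _ _).trans (add_le_add h1 (hM t ht))
  let gI : ℕ → C(Icc (0 : ℝ) r, X) := fun n => ⟨fun t => g n t, (hgc n).comp continuous_subtype_val⟩
  let kI : ℕ → C(Icc (0 : ℝ) r, X) := fun n => ⟨fun t => k n t, (hkc n).comp continuous_subtype_val⟩
  let fI : C(Icc (0 : ℝ) r, X) := ⟨fun t => f t, hf.comp continuous_subtype_val⟩
  have hlim : Tendsto (fun n : ℕ => 1 / ((n : ℝ) + 1)) atTop (𝓝 0) :=
    tendsto_one_div_add_atTop_nhds_zero_nat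
  have hgI : Tendsto gI atTop (𝓝 fI) := by
    rw [tendsto_iff_norm_sub_tendsto_zero]
    refine squeeze_zero (fun _ => norm_nonneg _) (fun n => ?_) hlim
    exact (ContinuousMap.norm_le _ (by positivity)).2 fun t => hgf n t t.2
  have hkI : CauchySeq kI := by
    rw [cauchySeq_iff_tendsto_dist_atTop_0]
    have h2 : Tendsto (fun p : ℕ × ℕ => (B + 1) * (1 / ((p.1 : ℝ) + 1) + 1 / ((p.2 : ℝ) + 1)))
        atTop (𝓝 0) := by
      rw [← prod_atTop_atTop_eq]
      simpa using ((hlim.comp tendsto_fst).add (hlim.comp tendsto_snd)).const_mul (B + 1)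
    refine squeeze_zero (fun _ => dist_nonneg) (fun p => ?_) h2
    rw [dist_eq_norm]
    exact (ContinuousMap.norm_le _ (by positivity)).2 fun t => hdiff p.1 p.2 t t.2
  obtain ⟨K, hK⟩ := cauchySeq_tendsto_of_complete hkI
  refine ⟨IccExtend hr.le K, K.continuous.Icc_extend', fun t ht => ?_⟩
  have hext : ∀ φ : ℝ → X, ∀ s ∈ Icc 0 t,
      φ s = IccExtend hr.le (fun τ : Icc (0 : ℝ) r => φ τ) s := fun φ s hs => by
    rw [IccExtend_of_mem _ _ ⟨hs.1, hs.2.trans ht.2⟩]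
  have t1 : Tendsto (fun n => opConv S (IccExtend hr.le (gI n)) t) atTop
      (𝓝 (opConv S (IccExtend hr.le fI) t)) :=
    (((continuous_opConv_param hS (continuous_IccExtend_uncurry hr.le)).comp
      (Continuous.prodMk_left t)).tendsto fI).comp hgI
  have t2 : Tendsto (fun n => fracConv 1 (IccExtend hr.le (kI n)) t) atTop
      (𝓝 (fracConv 1 (IccExtend hr.le K) t)) :=
    (((continuous_fracConv_param one_pos (continuous_IccExtend_uncurry hr.le)).comp
      (Continuous.prodMk_left t)).tendsto K).comp hK
  have e : ∀ n, opConv S (IccExtend hr.le (gI n)) t = fracConv 1 (IccExtend hr.le (kI n)) t := by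
    intro n
    exact (opConv_congr S ht.1 (hext (g n))).symm.trans
      ((opConv_eq_fracConv_one hS (hg n) (hg' n) ht.1).trans (fracConv_congr 1 ht.1 (hext (k n))))
  simp only [e] at t1
  exact (opConv_congr S ht.1 (hext f)).trans (tendsto_nhds_unique t1 t2)

end

/-! ### Strong solutions and the integrated equation. -/

section

section
variable {X : Type u} [NormedAddCommGroup X] [NormedSpace ℝ X] [CompleteSpace X]

lemma deriv_fracConv_one {g : ℝ → X} (hg : Continuous g) : deriv (fracConv 1 g) = g :=
  funext fun t => (hasDerivAt_fracConv_one hg t).deriv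

lemma contDiff_one_fracConv_one {g : ℝ → X} (hg : Continuous g) : ContDiff ℝ 1 (fracConv 1 g) := by
  rw [contDiff_one_iff_deriv, deriv_fracConv_one hg]
  exact ⟨fun t => (hasDerivAt_fracConv_one hg t).differentiableAt, hg⟩

lemma contDiff_two_fracConv_one {g : ℝ → X} (hg : Continuous g) :
    ContDiff ℝ 2 (fracConv 1 (fracConv 1 g)) := by
  have hc := continuous_fracConv one_pos hg
  rw [show (2 : WithTop ℕ∞) = 1 + 1 from rfl, contDiff_succ_iff_deriv, deriv_fracConv_one hc]
  exact ⟨fun t => (hasDerivAt_fracConv_one hc t).differentiableAt, by simp,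
    contDiff_one_fracConv_one hg⟩

lemma derivWithin_fracConv_one {r : ℝ} (hr : 0 < r) {g : ℝ → X} (hg : Continuous g) {t : ℝ}
    (ht : t ∈ Icc 0 r) : derivWithin (fracConv 1 g) (Icc 0 r) t = g t :=
  (hasDerivAt_fracConv_one hg t).hasDerivWithinAt.derivWithin (uniqueDiffOn_Icc hr t ht)

lemma iteratedDerivWithin_two_fracConv_one {r : ℝ} (hr : 0 < r) {g : ℝ → X} (hg : Continuous g)
    {t : ℝ} (ht : t ∈ Icc 0 r) :
    iteratedDerivWithin 2 (fracConv 1 (fracConv 1 g)) (Icc 0 r) t = g t := by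
  rw [show (2 : ℕ) = 1 + 1 from rfl, iteratedDerivWithin_succ, iteratedDerivWithin_one,
    derivWithin_congr (fun s hs => derivWithin_fracConv_one hr (continuous_fracConv one_pos hg) hs)
      (derivWithin_fracConv_one hr (continuous_fracConv one_pos hg) ht),
    derivWithin_fracConv_one hr hg ht]

/-- The fundamental theorem of calculus for a function which is `C¹` on `[0,r]`. -/
lemma exists_eq_add_fracConv_one {r : ℝ} (hr : 0 < r) {u : ℝ → X}
    (hu : ContDiffOn ℝ 1 u (Icc 0 r)) : ∃ p : ℝ → X, Continuous p ∧
      ∀ t ∈ Icc 0 r, p t = derivWithin u (Icc 0 r) t ∧ u t = u 0 + fracConv 1 p t := by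
  have hd : ContinuousOn (derivWithin u (Icc 0 r)) (Icc 0 r) :=
    ((contDiffOn_one_iff_derivWithin (uniqueDiffOn_Icc hr)).1 hu).2
  refine ⟨IccExtend hr.le ((Icc 0 r).domRestrict (derivWithin u (Icc 0 r))),
    hd.domRestrict.Icc_extend', fun t ht => ?_⟩
  have hp : ∀ s ∈ Icc 0 r, IccExtend hr.le ((Icc 0 r).domRestrict (derivWithin u (Icc 0 r))) s =
      derivWithin u (Icc 0 r) s := fun s hs => by rw [IccExtend_of_mem _ _ hs]; rfl
  refine ⟨hp t ht, ?_⟩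
  have hs : Icc 0 t ⊆ Icc 0 r := Icc_subset_Icc_right ht.2
  rw [fracConv_one, intervalIntegral.integral_eq_sub_of_hasDeriv_right (f := u)
    (by rw [uIcc_of_le ht.1]; exact hu.continuousOn.mono hs) ?_
    (hd.domRestrict.Icc_extend'.intervalIntegrable _ _), add_sub_cancel]
  intro s hs
  rw [min_eq_left ht.1, max_eq_right ht.1] at hs
  have hs' : s ∈ Icc 0 r := ⟨hs.1.le, hs.2.le.trans ht.2⟩
  rw [hp s hs']
  exact ((hu.differentiableOn one_ne_zero s hs').hasDerivWithinAt.hasDerivAt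
    (Icc_mem_nhds hs.1 (hs.2.trans_le ht.2))).hasDerivWithinAt

end

section
variable {𝕜 : Type*} {X : Type u} [RCLike 𝕜] [NormedAddCommGroup X] [NormedSpace ℝ X]
  [NormedSpace 𝕜 X] [CompleteSpace X] {α r : ℝ} {A : X →ₗ.[𝕜] X} {x y : X} {f u : ℝ → X}

omit [NormedSpace ℝ X] [CompleteSpace X] in
lemma LinearPMap.exists_apply_eq_of_mem_graph {p q : X} (h : (p, q) ∈ A.graph) :
    ∃ hp : p ∈ A.domain, A ⟨p, hp⟩ = q := by
  obtain ⟨z, hz1, hz2⟩ := (LinearPMap.mem_graph_iff A).1 h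
  simp only at hz1 hz2
  subst hz1
  exact ⟨z.2, hz2⟩

/-- A solution of the integrated problem `u = x + t y + g_α * (A u + f)` is a strong solution. -/
lemma isStrongSolution_of_eq_fracConv (hα₁ : 1 < α) (hα₂ : α < 2) (hr : 0 < r)
    (hf : ContinuousOn f (Icc 0 r)) {m : ℝ → X} (hm : Continuous m)
    (hG : ∀ t ∈ Icc 0 r, (u t, m t - f t) ∈ A.graph)
    (hu : ∀ t ∈ Icc 0 r, u t = x + t • y + fracConv α m t) : IsStrongSolution α r A x y f u := by
  have hc1 : Continuous (fracConv (α - 1) m) := continuous_fracConv (by linarith) hm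
  have h0 : (0 : ℝ) ∈ Icc 0 r := ⟨le_rfl, hr.le⟩
  have hu1 : EqOn u (fun t => x + t • y + fracConv 1 (fracConv (α - 1) m) t) (Icc 0 r) :=
    fun t ht => by
    simp only [hu t ht, fracConv_eq_add_primitive hα₁ hm ht.1]
  have hinit : u 0 = x := by simp [hu 0 h0]
  have hderiv : derivWithin u (Icc 0 r) 0 = y := by
    have hd : HasDerivAt (fun t : ℝ => x + t • y + fracConv 1 (fracConv (α - 1) m) t)
        ((1 : ℝ) • y + fracConv (α - 1) m 0) 0 :=
      (((hasDerivAt_id (0 : ℝ)).smul_const y).const_add x).add (hasDerivAt_fracConv_one hc1 0)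
    rw [(hd.hasDerivWithinAt.congr hu1 (hu1 h0)).derivWithin (uniqueDiffOn_Icc hr 0 h0)]
    simp
  -- `g_{2-α} * g_α = g_2 = 1 * 1`, so the Caputo derivative of `u` will be `m`.
  have hconv : EqOn (fracConv (2 - α) (fun s => u s - x - s • y)) (fracConv 1 (fracConv 1 m))
      (Icc 0 r) := fun t ht => by
    rw [fracConv_congr (2 - α) (g := fracConv α m) ht.1 fun s hs => ?_,
      fracConv_fracConv (by linarith) (by linarith) hm ht.1,
      fracConv_fracConv one_pos one_pos hm ht.1]
    · congr 1; ring
    · simp only [hu s ⟨hs.1, hs.2.trans ht.2⟩]; abel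
  have hdom : ∀ t ∈ Icc 0 r, u t ∈ A.domain := fun t ht =>
    (LinearPMap.exists_apply_eq_of_mem_graph (hG t ht)).1
  have hA : ∀ t (ht : t ∈ Icc 0 r), A ⟨u t, hdom t ht⟩ = m t - f t := fun t ht =>
    (LinearPMap.exists_apply_eq_of_mem_graph (hG t ht)).2
  refine ⟨hdom, ?_, ?_, (contDiff_two_fracConv_one hm).contDiffOn.congr hconv, hinit, hderiv,
    fun t ht => ?_⟩
  · have : (fun t : Icc (0 : ℝ) r => A ⟨u t, hdom t t.2⟩) =
        fun t : Icc (0 : ℝ) r => m t - (Icc 0 r).domRestrict f t := funext fun t => hA t t.2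
    rw [this]
    exact (hm.comp continuous_subtype_val).sub hf.domRestrict
  · refine ContDiffOn.congr (ContDiff.contDiffOn ?_) hu1
    exact (contDiff_const.add (contDiff_id.smul contDiff_const)).add (contDiff_one_fracConv_one hc1)
  · rw [hA t ht, sub_add_cancel, caputoDeriv, hinit, hderiv,
      iteratedDerivWithin_congr hconv ht, iteratedDerivWithin_two_fracConv_one hr hm ht]

/-- A strong solution solves the integrated problem `u = x + t y + g_α * (A u + f)`. -/
lemma IsStrongSolution.exists_eq_fracConv (h : IsStrongSolution α r A x y f u) (hα₁ : 1 < α)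
    (hα₂ : α < 2) (hr : 0 < r) : ∃ m : ℝ → X, Continuous m ∧
      (∀ t ∈ Icc 0 r, (u t, m t - f t) ∈ A.graph) ∧
      ∀ t ∈ Icc 0 r, u t = x + t • y + fracConv α m t := by
  obtain ⟨p, hp, hpu⟩ := exists_eq_add_fracConv_one hr h.contDiffOn_one
  set q : ℝ → X := fun s => p s - y with hq
  have hqc : Continuous q := by fun_prop
  have hv : ∀ t ∈ Icc 0 r, u t - x - t • y = fracConv 1 q t := fun t ht => by
    rw [(hpu t ht).2, h.initial, hq, fracConv_sub one_pos hp continuous_const,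
      fracConv_one (fun _ => y), intervalIntegral.integral_const, sub_zero]
    abel
  have hα2 : 0 < 2 - α := by linarith
  set w₁ := fracConv (2 - α) q with hw₁
  have hw₁c : Continuous w₁ := continuous_fracConv hα2 hqc
  set w := fracConv (2 - α) (fun s => u s - x - s • y) with hw
  have hww : EqOn w (fracConv 1 w₁) (Icc 0 r) := fun t ht => by
    rw [hw, fracConv_congr (2 - α) ht.1 fun s hs => hv s ⟨hs.1, hs.2.trans ht.2⟩,
      fracConv_fracConv hα2 one_pos hqc ht.1, hw₁, fracConv_fracConv one_pos hα2 hqc ht.1, add_comm]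
  have hwd : EqOn (derivWithin w (Icc 0 r)) w₁ (Icc 0 r) := fun t ht => by
    rw [derivWithin_congr hww (hww ht), derivWithin_fracConv_one hr hw₁c ht]
  have hw₁d : ContDiffOn ℝ 1 w₁ (Icc 0 r) := by
    have := h.contDiffOn_two
    rw [show (2 : WithTop ℕ∞) = 1 + 1 from rfl,
      contDiffOn_succ_iff_derivWithin (uniqueDiffOn_Icc hr)] at this
    exact this.2.2.congr fun t ht => (hwd ht).symm
  obtain ⟨m, hm, hmw⟩ := exists_eq_add_fracConv_one hr hw₁d
  have hmcap : ∀ t ∈ Icc 0 r, caputoDeriv α r u t = m t := fun t ht => by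
    rw [caputoDeriv, h.initial, h.initial_deriv, (hmw t ht).1, show (2 : ℕ) = 1 + 1 from rfl,
      iteratedDerivWithin_succ, iteratedDerivWithin_one]
    exact derivWithin_congr hwd (hwd ht)
  -- No constant of integration appears, because the convolution `w₁` vanishes at `0`.
  have hw₁m : ∀ t ∈ Icc 0 r, w₁ t = fracConv 1 m t := fun t ht => by
    rw [(hmw t ht).2, hw₁, fracConv_zero_right, zero_add]
  have hα0 : 0 < α := by linarith
  refine ⟨m, hm, fun t ht => ?_, fun t ht => ?_⟩
  · have := LinearPMap.mem_graph A ⟨u t, h.mem_domain t ht⟩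
    rwa [← hmcap t ht, h.equation t ht, add_sub_cancel_right]
  -- Convolving `g_{2-α} * q = 1 * m` with `g_α` gives `1 * (1 * q) = 1 * (g_α * m)`; one primitive
  -- is then cancelled.
  · have key : EqOn (fracConv 1 q) (fracConv α m) (Icc 0 r) := by
      refine eqOn_of_fracConv_one_eqOn hr (continuous_fracConv one_pos hqc)
        (continuous_fracConv hα0 hm) fun t ht => ?_
      have e := fracConv_congr α ht.1 fun s hs => hw₁m s ⟨hs.1, hs.2.trans ht.2⟩
      rw [hw₁, fracConv_fracConv hα0 hα2 hqc ht.1, fracConv_fracConv hα0 one_pos hm ht.1] at e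
      rw [fracConv_fracConv one_pos one_pos hqc ht.1, fracConv_fracConv one_pos hα0 hm ht.1,
        add_comm 1 α, ← e]
      congr 1; ring
    rw [← key ht, ← hv t ht]; abel

end

end

/-! ### Necessity of bounded semivariation: open mapping theorem and smooth ramps. -/

section

variable {X : Type u} [NormedAddCommGroup X] [NormedSpace ℝ X] [CompleteSpace X]

namespace IsResolventOn

variable {α r : ℝ} {G : Submodule ℝ (X × X)} {S : ℝ → X →L[ℝ] X} (h : IsResolventOn α r G S)
include h

omit h in
lemma fracConv_opConv_eq (hα : 1 < α) {f k : ℝ → X}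
    (hk : Continuous k) (hfk : EqOn (opConv S f) (fracConv 1 k) (Icc 0 r)) {t : ℝ}
    (ht : t ∈ Icc 0 r) : fracConv (α - 1) (opConv S f) t = fracConv α k t := by
  rw [fracConv_congr (α - 1) ht.1 fun s hs => hfk ⟨hs.1, hs.2.trans ht.2⟩,
    fracConv_fracConv (by linarith) one_pos hk ht.1, sub_add_cancel]

/-- If `S * f` has the derivative `k`, then `g_α * k` takes its values in the domain of `A`, and
`A (g_α * k) = k - f`. -/
lemma fracConv_mem_of_opConv_eq (hα : 1 < α) (hr : 0 < r) {f k : ℝ → X} (hf : Continuous f)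
    (hk : Continuous k) (hfk : EqOn (opConv S f) (fracConv 1 k) (Icc 0 r)) :
    ∀ t ∈ Icc 0 r, (fracConv α k t, k t - f t) ∈ G := by
  have hα0 : 0 < α := by linarith
  -- With `S * f = 1 * k`, `fracConv_opConv_mem` reads `A(1 * (g_α * k)) = 1 * (k - f)`, which is
  -- differentiated through the closed graph.
  refine mem_of_fracConv_one_mem h.isClosed hr (continuous_fracConv hα0 hk) (hk.sub hf)
    fun t ht => ?_
  have h1 := h.fracConv_opConv_mem hα0 hf ht
  rw [fracConv_congr α ht.1 fun s hs => hfk ⟨hs.1, hs.2.trans ht.2⟩,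
    fracConv_fracConv hα0 one_pos hk ht.1, hfk ht, ← fracConv_sub one_pos hk hf] at h1
  rwa [fracConv_fracConv one_pos hα0 hk ht.1, add_comm]

omit [CompleteSpace X] in
/-- The map `f ↦ (P_α * f)(r)` on `C([0,r];X)`. -/
lemma exists_continuousLinearMap (hα : 1 < α) (hr : 0 ≤ r) : ∃ L : C(Icc (0 : ℝ) r, X) →L[ℝ] X,
    ∀ g, L g = fracConv (α - 1) (opConv S (IccExtend hr g)) r := by
  have hα1 : 0 < α - 1 := by linarith
  have hc : ∀ g : C(Icc (0 : ℝ) r, X), Continuous (IccExtend hr g) := fun g =>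
    g.continuous.Icc_extend'
  refine ⟨⟨⟨⟨fun g => fracConv (α - 1) (opConv S (IccExtend hr g)) r, fun g₁ g₂ => ?_⟩,
    fun c g => ?_⟩, ?_⟩, fun g => rfl⟩
  · rw [← fracConv_add hα1 (continuous_opConv h.continuous (hc g₁))
      (continuous_opConv h.continuous (hc g₂))]
    congr 1
    exact funext fun t => opConv_add h.continuous (hc g₁) (hc g₂) t
  · change fracConv (α - 1) (opConv S (fun s => c • IccExtend hr g s)) r = c • _
    rw [← fracConv_smul]
    congr 1
    exact funext fun t => opConv_smul c (IccExtend hr g) t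
  · exact (continuous_fracConv_param hα1 (F := fun g : C(Icc (0 : ℝ) r, X) =>
      opConv S (IccExtend hr g)) (continuous_opConv_param h.continuous
      (continuous_IccExtend_uncurry hr))).comp (Continuous.prodMk_left r)

/-- A closed operator composed with a bounded one is bounded if it is defined everywhere. -/
lemma exists_norm_le_of_forall_mem {E : Type*} [NormedAddCommGroup E]
    [NormedSpace ℝ E] [CompleteSpace E] (L : E →L[ℝ] X) (hL : ∀ g, ∃ y, (L g, y) ∈ G) :
    ∃ C, ∀ g y, (L g, y) ∈ G → ‖y‖ ≤ C * ‖g‖ := by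
  let q : E × X →L[ℝ] X × X := L.prodMap (ContinuousLinearMap.id ℝ X)
  let H : Submodule ℝ (E × X) := G.comap (q : E × X →ₗ[ℝ] X × X)
  have hH : IsClosed (H : Set (E × X)) := h.isClosed.preimage q.continuous
  have : CompleteSpace H := hH.completeSpace_coe
  -- The projection of the closed subspace `H` to `E` is onto, so the open mapping theorem gives
  -- preimages of controlled norm. The second component of a preimage is unique because `G` is the
  -- graph of a function.
  obtain ⟨C, -, hC⟩ := ContinuousLinearMap.exists_preimage_norm_le
    ((ContinuousLinearMap.fst ℝ E X).comp H.subtypeL) fun g => by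
      obtain ⟨y, hy⟩ := hL g
      exact ⟨⟨(g, y), hy⟩, rfl⟩
  refine ⟨C, fun g y hy => ?_⟩
  obtain ⟨⟨⟨g', y'⟩, hg'⟩, rfl, hle⟩ := hC g
  have e : y = y' := h.eq_of_mem hy hg'
  rw [e]
  exact (norm_snd_le (g', y')).trans hle

end IsResolventOn

section ramp

open Real

lemma continuous_deriv_smoothTransition : Continuous (deriv smoothTransition) :=
  (smoothTransition.contDiff (n := 1)).continuous_deriv le_rfl

lemma hasDerivAt_smoothTransition (x : ℝ) :
    HasDerivAt smoothTransition (deriv smoothTransition x) x :=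
  ((smoothTransition.contDiff (n := 1)).differentiable one_ne_zero x).hasDerivAt

lemma deriv_smoothTransition_nonneg (x : ℝ) : 0 ≤ deriv smoothTransition x :=
  smoothTransition.monotone.deriv_nonneg

lemma deriv_smoothTransition_eq_zero {x : ℝ} (hx : x ∉ Icc (0 : ℝ) 1) :
    deriv smoothTransition x = 0 := by
  rcases lt_or_ge x 0 with h | h
  · rw [Filter.EventuallyEq.deriv_eq (f := fun _ => (0 : ℝ)), deriv_const]
    filter_upwards [Iio_mem_nhds h] with s hs using smoothTransition.zero_of_nonpos (le_of_lt hs)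
  · have h1 : 1 < x := by by_contra! h1; exact hx ⟨h, h1⟩
    rw [Filter.EventuallyEq.deriv_eq (f := fun _ => (1 : ℝ)), deriv_const]
    filter_upwards [Ioi_mem_nhds h1] with s hs using smoothTransition.one_of_one_le (le_of_lt hs)

/-- For `ε > 0` the ramp is a `C¹` version of the indicator of `[0, r - d]`: it is `1` for `s ≤ r -
d - ε` and `0` for `s ≥ r - d`. -/
lemma hasDerivAt_ramp (r d ε s : ℝ) :
    HasDerivAt (fun s => smoothTransition ((r - s - d) / ε))
      (-(ε⁻¹ * deriv smoothTransition ((r - s - d) / ε))) s := by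
  have h1 : HasDerivAt (fun s : ℝ => (r - s - d) / ε) (-1 / ε) s :=
    (((hasDerivAt_id s).const_sub r).sub_const d).div_const ε
  have h2 := (hasDerivAt_smoothTransition ((r - s - d) / ε)).comp s h1
  exact h2.congr_deriv (by ring)

lemma integral_deriv_smoothTransition {r d ε : ℝ} (hd : 0 ≤ d) (hε : 0 < ε) :
    ∫ s in (0 : ℝ)..r, ε⁻¹ * deriv smoothTransition ((s - d) / ε) =
      smoothTransition ((r - d) / ε) := by
  have hder : ∀ s, HasDerivAt (fun s => smoothTransition ((s - d) / ε))
      (ε⁻¹ * deriv smoothTransition ((s - d) / ε)) s := fun s => by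
    have h1 : HasDerivAt (fun s : ℝ => (s - d) / ε) (1 / ε) s :=
      ((hasDerivAt_id s).sub_const d).div_const ε
    have h2 := (hasDerivAt_smoothTransition ((s - d) / ε)).comp s h1
    exact h2.congr_deriv (by ring)
  have hc := continuous_deriv_smoothTransition
  rw [intervalIntegral.integral_eq_sub_of_hasDerivAt (fun s _ => hder s)
    (by apply Continuous.intervalIntegrable; fun_prop),
    smoothTransition.zero_of_nonpos (x := (0 - d) / ε)
      (div_nonpos_of_nonpos_of_nonneg (by linarith) hε.le), sub_zero]

/-- The derivative of `S * f` at `r`, minus `f(r)`, for the ramp `f(s) = ρ((r - s - d)/ε) z`,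
converges to `S(r) z - S(d) z` as `ε → 0`. -/
lemma tendsto_ramp {S : ℝ → X →L[ℝ] X} (hS : Continuous fun p : ℝ × X => S p.1 p.2) {r d : ℝ}
    (hd : d ∈ Icc 0 r) (z : X) :
    Tendsto (fun ε : ℝ => S r (smoothTransition ((r - 0 - d) / ε) • z) +
      opConv S (fun s => (-(ε⁻¹ * deriv smoothTransition ((r - s - d) / ε))) • z) r -
      smoothTransition ((r - r - d) / ε) • z) (𝓝[>] 0) (𝓝 (S r z - S d z)) := by
  have hSz : Continuous fun s => S s z := continuous_apply_comp hS continuous_id continuous_const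
  rw [Metric.tendsto_nhds]
  intro η hη
  obtain ⟨δ, hδ, hδ'⟩ := Metric.continuousAt_iff.1 (hSz.continuousAt (x := d)) (η / 2) (by positivity)
  have h1 : ∀ᶠ ε : ℝ in 𝓝[>] 0, ε < δ := mem_nhdsWithin_of_mem_nhds (Iio_mem_nhds hδ)
  have h2 : ∀ᶠ ε : ℝ in 𝓝[>] 0, d < r → ε < r - d := by
    by_cases hdr : d < r
    · filter_upwards [mem_nhdsWithin_of_mem_nhds (Iio_mem_nhds (sub_pos.2 hdr))] with ε hε _ using hε
    · exact Eventually.of_forall fun ε h => absurd h hdr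
  filter_upwards [h1, h2, self_mem_nhdsWithin] with ε hε1 hε2 hε0
  have hε0 : 0 < ε := hε0
  set c := smoothTransition ((r - d) / ε) with hc
  -- After the reflection `s ↦ r - s` the derivative of the ramp is `-w`, with `w` a nonnegative
  -- mollifier supported in `[d, d + ε]`.
  set w : ℝ → ℝ := fun s => ε⁻¹ * deriv smoothTransition ((s - d) / ε) with hw
  have hwc : Continuous w := by
    have := continuous_deriv_smoothTransition
    fun_prop
  have hw0 : ∀ s, 0 ≤ w s := fun s =>
    mul_nonneg (by positivity) (deriv_smoothTransition_nonneg _)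
  have hwi : ∫ s in (0 : ℝ)..r, w s = c := integral_deriv_smoothTransition hd.1 hε0
  have e1 : opConv S (fun s => (-(ε⁻¹ * deriv smoothTransition ((r - s - d) / ε))) • z) r =
      -∫ s in (0 : ℝ)..r, w s • S s z := by
    rw [opConv_eq, ← intervalIntegral.integral_neg]
    refine intervalIntegral.integral_congr fun s _ => ?_
    simp only [sub_sub_cancel, neg_smul, map_neg, map_smul, hw]
  have e2 : smoothTransition ((r - r - d) / ε) = 0 := smoothTransition.zero_of_nonpos
    (div_nonpos_of_nonpos_of_nonneg (by linarith [hd.1]) hε0.le)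
  -- If `d < r`, then `ε < r - d` gives `w` the full mass `c = 1`; if `d = r`, the vector is zero
  -- and `c` is irrelevant.
  have e3 : c • (S r z - S d z) = S r z - S d z := by
    rcases hd.2.eq_or_lt with h | h
    · rw [h, sub_self, smul_zero]
    · rw [hc, smoothTransition.one_of_one_le, one_smul]
      rw [le_div_iff₀ hε0]
      linarith [hε2 h]
  have e4 : ∫ s in (0 : ℝ)..r, w s • (S s z - S d z) =
      (∫ s in (0 : ℝ)..r, w s • S s z) - c • S d z := by
    simp only [smul_sub]
    have i1 : IntervalIntegrable (fun s => w s • S s z) volume 0 r :=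
      (hwc.smul hSz).intervalIntegrable _ _
    have i2 : IntervalIntegrable (fun s => w s • S d z) volume 0 r :=
      (hwc.smul continuous_const).intervalIntegrable _ _
    rw [intervalIntegral.integral_sub i1 i2, intervalIntegral.integral_smul_const, hwi]
  have e5 : S r (smoothTransition ((r - 0 - d) / ε) • z) +
      opConv S (fun s => (-(ε⁻¹ * deriv smoothTransition ((r - s - d) / ε))) • z) r -
      smoothTransition ((r - r - d) / ε) • z - (S r z - S d z) =
      -∫ s in (0 : ℝ)..r, w s • (S s z - S d z) := by
    rw [e1, e2, zero_smul, sub_zero, sub_zero, ← hc, map_smul, e4, ← e3, smul_sub]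
    abel
  rw [dist_eq_norm, e5, norm_neg]
  have hbd : ‖∫ s in (0 : ℝ)..r, w s • (S s z - S d z)‖ ≤ ∫ s in (0 : ℝ)..r, w s * (η / 2) := by
    refine intervalIntegral.norm_integral_le_of_norm_le (hd.1.trans hd.2)
      (Eventually.of_forall fun s _ => ?_) ((hwc.mul continuous_const).intervalIntegrable _ _)
    rw [norm_smul, Real.norm_of_nonneg (hw0 s)]
    by_cases hs : (s - d) / ε ∈ Icc (0 : ℝ) 1
    · refine mul_le_mul_of_nonneg_left ?_ (hw0 s)
      rw [← dist_eq_norm]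
      refine (hδ' ?_).le
      have h3 : 0 ≤ s - d := by
        by_contra! hneg
        exact absurd hs.1 (not_le.2 (div_neg_of_neg_of_pos hneg hε0))
      rw [Real.dist_eq, abs_of_nonneg h3]
      have := (div_le_one hε0).1 hs.2
      linarith
    · simp [hw, deriv_smoothTransition_eq_zero hs]
  refine hbd.trans_lt ?_
  rw [intervalIntegral.integral_mul_const, hwi]
  have : c ≤ 1 := smoothTransition.le_one _
  nlinarith

lemma sum_castSucc_sub_succ {n : ℕ} (F : Fin (n + 1) → ℝ) :
    ∑ i : Fin n, (F i.castSucc - F i.succ) = F 0 - F (Fin.last n) := by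
  induction n with
  | zero => simp
  | succ n ih =>
    rw [Fin.sum_univ_castSucc]
    have := ih fun i => F i.castSucc
    simp only [Fin.succ_castSucc, Fin.succ_last] at this ⊢
    rw [this]
    simp

/-- If `A (P_α * f)(r)` exists for all continuous `f`, then `S` has bounded semivariation. -/
lemma IsResolventOn.exists_semivariationLE {α r : ℝ} {G : Submodule ℝ (X × X)}
    {S : ℝ → X →L[ℝ] X} (h : IsResolventOn α r G S) (hα : 1 < α) (hr : 0 < r)
    (hdom : ∀ f : ℝ → X, Continuous f → ∃ y, (fracConv (α - 1) (opConv S f) r, y) ∈ G) :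
    ∃ B, SemivariationLE r S B := by
  obtain ⟨L, hL⟩ := h.exists_continuousLinearMap hα hr.le
  obtain ⟨C, hC⟩ := h.exists_norm_le_of_forall_mem L fun g => by
    rw [hL]; exact hdom _ g.continuous.Icc_extend'
  have hr0 : r ∈ Icc 0 r := ⟨hr.le, le_rfl⟩
  have hC0 : ∀ g y, (L g, y) ∈ G → ‖g‖ ≤ 1 → ‖y‖ ≤ |C| := fun g y hy hg =>
    (hC g y hy).trans ((mul_le_mul_of_nonneg_right (le_abs_self C) (norm_nonneg g)).trans
      (mul_le_of_le_one_right (abs_nonneg C) hg))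
  let e : ℝ → X → ℝ → C(Icc (0 : ℝ) r, X) := fun d z ε =>
    ⟨fun s => smoothTransition ((r - s - d) / ε) • z, by
      have := smoothTransition.continuous
      fun_prop⟩
  set T : ℝ → X → ℝ → X := fun d z ε => S r (smoothTransition ((r - 0 - d) / ε) • z) +
      opConv S (fun s => (-(ε⁻¹ * deriv smoothTransition ((r - s - d) / ε))) • z) r -
      smoothTransition ((r - r - d) / ε) • z with hT
  -- The ramp is `C¹`, so `A` applied to `(P_α * f)(r)` is explicitly `(S * f)'(r) - f(r)`.
  have heT : ∀ d z ε, (L (e d z ε), T d z ε) ∈ G := by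
    intro d z ε
    set f : ℝ → X := fun s => smoothTransition ((r - s - d) / ε) • z with hf
    set f' : ℝ → X := fun s => (-(ε⁻¹ * deriv smoothTransition ((r - s - d) / ε))) • z with hf'
    have hfc : Continuous f := by
      have := smoothTransition.continuous
      fun_prop
    have hf'c : Continuous f' := by
      have := continuous_deriv_smoothTransition
      fun_prop
    have hff' : ∀ s, HasDerivAt f (f' s) s := fun s => (hasDerivAt_ramp r d ε s).smul_const z
    have hk := continuous_apply_add_opConv h.continuous (f 0) hf'c
    have hfk : EqOn (opConv S f) (fracConv 1 fun t => S t (f 0) + opConv S f' t) (Icc 0 r) :=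
      fun t ht => opConv_eq_fracConv_one h.continuous hff' hf'c ht.1
    have e1 : L (e d z ε) = fracConv α (fun t => S t (f 0) + opConv S f' t) r := by
      rw [hL, ← IsResolventOn.fracConv_opConv_eq hα hk hfk hr0]
      refine fracConv_congr _ hr.le fun t ht => opConv_congr S ht.1 fun s hs => ?_
      rw [IccExtend_of_mem _ _ ⟨hs.1, hs.2.trans ht.2⟩]
      rfl
    rw [e1]
    exact h.fracConv_mem_of_opConv_eq hα hr hfc hk hfk r hr0
  refine ⟨|C|, fun p x hx => ?_⟩
  have hpd : ∀ i, p.d i ∈ Icc 0 r := fun i =>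
    ⟨p.first.symm.trans_le (p.strictMono.monotone (Fin.zero_le i)),
      (p.strictMono.monotone (Fin.le_last i)).trans_eq p.last⟩
  -- A difference of ramps at consecutive points approximates the indicator of one reflected
  -- subinterval; in the limit the terms `S(r) xᵢ` cancel.
  have hlim : Tendsto (fun ε => ∑ i : Fin p.n,
      (T (p.d i.castSucc) (x i) ε - T (p.d i.succ) (x i) ε)) (𝓝[>] 0)
      (𝓝 (∑ i : Fin p.n, ((S r (x i) - S (p.d i.castSucc) (x i)) -
        (S r (x i) - S (p.d i.succ) (x i))))) :=
    tendsto_finsetSum _ fun i _ => (tendsto_ramp h.continuous (hpd _) _).sub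
      (tendsto_ramp h.continuous (hpd _) _)
  simp only [sub_sub_sub_cancel_left] at hlim
  refine le_of_tendsto hlim.norm ?_
  filter_upwards [self_mem_nhdsWithin] with ε hε
  have hε : 0 < ε := hε
  refine hC0 (∑ i : Fin p.n, (e (p.d i.castSucc) (x i) ε - e (p.d i.succ) (x i) ε)) _ ?_ ?_
  · have := G.sum_mem (t := Finset.univ) fun (i : Fin p.n) _ =>
      G.sub_mem (heT (p.d i.castSucc) (x i) ε) (heT (p.d i.succ) (x i) ε)
    convert this using 1
    ext <;> simp [Prod.fst_sum, Prod.snd_sum]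
  · refine (ContinuousMap.norm_le _ zero_le_one).2 fun s => ?_
    rw [ContinuousMap.sum_apply]
    -- At each `s` the coefficients of the `xᵢ` are nonnegative and telescope to at most `1`, so the
    -- test function has norm at most `1` however fine the subdivision.
    set F : Fin (p.n + 1) → ℝ := fun i => smoothTransition ((r - s - p.d i) / ε) with hF
    have hmono : ∀ i : Fin p.n, 0 ≤ F i.castSucc - F i.succ := fun i => by
      refine sub_nonneg.2 (smoothTransition.monotone ?_)
      have := p.strictMono.monotone (Fin.castSucc_lt_succ (i := i)).le
      gcongr
    calc ‖∑ i : Fin p.n, (e (p.d i.castSucc) (x i) ε - e (p.d i.succ) (x i) ε) s‖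
        ≤ ∑ i : Fin p.n, (F i.castSucc - F i.succ) := by
          refine norm_sum_le_of_le _ fun i _ => ?_
          have : (e (p.d i.castSucc) (x i) ε - e (p.d i.succ) (x i) ε) s =
              (F i.castSucc - F i.succ) • x i := (sub_smul _ _ _).symm
          rw [this, norm_smul, Real.norm_of_nonneg (hmono i)]
          exact mul_le_of_le_one_right (hmono i) (hx i)
      _ = F 0 - F (Fin.last _) := sum_castSucc_sub_succ F
      _ ≤ 1 := by
          have h1 : F 0 ≤ 1 := smoothTransition.le_one _
          have h2 : 0 ≤ F (Fin.last _) := smoothTransition.nonneg _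
          linarith

end ramp

end

/-! ### From the operator `A` over `𝕜` to its real graph, and conclusion. -/

section

variable {𝕜 : Type*} {X : Type u} [RCLike 𝕜] [NormedAddCommGroup X] [NormedSpace ℝ X]
  [NormedSpace 𝕜 X] [IsScalarTower ℝ 𝕜 X]

/-- The restriction of an operator family to `[0,r]`, extended to `ℝ` by its boundary values. -/
noncomputable def clampedFamily {r : ℝ} (hr : 0 ≤ r) (S : ℝ → X →L[𝕜] X) (t : ℝ) : X →L[ℝ] X :=
  (S (projIcc 0 r hr t)).restrictScalars ℝ

lemma clampedFamily_apply {r : ℝ} (hr : 0 ≤ r) (S : ℝ → X →L[𝕜] X) {t : ℝ} (ht : t ∈ Icc 0 r)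
    (z : X) : clampedFamily hr S t z = S t z := by
  simp [clampedFamily, projIcc_of_mem hr ht]

open scoped ENNReal in
lemma hasBoundedSemivariation_iff {r : ℝ} (hr : 0 ≤ r) (S : ℝ → X →L[𝕜] X) :
    HasBoundedSemivariation 0 r S ↔ ∃ B, SemivariationLE r (clampedFamily hr S) B := by
  have hpd : ∀ (p : Subdivision 0 r) i, p.d i ∈ Icc 0 r := fun p i =>
    ⟨p.first.symm.trans_le (p.strictMono.monotone (Fin.zero_le i)),
      (p.strictMono.monotone (Fin.le_last i)).trans_eq p.last⟩
  have e : ∀ (p : Subdivision 0 r) (x : Fin p.n → X),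
      ∑ i : Fin p.n, (S (p.d i.succ) - S (p.d i.castSucc)) (x i) =
      ∑ i : Fin p.n, (clampedFamily hr S (p.d i.succ) (x i) -
        clampedFamily hr S (p.d i.castSucc) (x i)) := fun p x => by
    refine Finset.sum_congr rfl fun i _ => ?_
    rw [clampedFamily_apply hr S (hpd p _), clampedFamily_apply hr S (hpd p _)]
    rfl
  constructor
  · intro h
    refine ⟨(semivariation 0 r S).toReal, fun p x hx => ?_⟩
    rw [← e, ← toReal_enorm]
    refine ENNReal.toReal_mono (ne_of_lt h) ?_
    exact (le_iSup₂ (f := fun (x : Fin p.n → X) (_ : ∀ i, ‖x i‖ ≤ 1) =>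
      ‖∑ i : Fin p.n, (S (p.d i.succ) - S (p.d i.castSucc)) (x i)‖ₑ) x hx).trans
      (le_iSup (fun p : Subdivision 0 r => semivariationOn S p) p)
  · rintro ⟨B, hB⟩
    refine lt_of_le_of_lt (iSup_le fun p => iSup₂_le fun x hx => ?_)
      (ENNReal.ofReal_lt_top (r := B))
    rw [e, ← ofReal_norm]
    exact ENNReal.ofReal_le_ofReal (hB p x hx)

variable [CompleteSpace X]

/-- A family that is strongly continuous on `[0,∞)` is jointly continuous. -/
lemma continuous_clampedFamily {r : ℝ} (hr : 0 ≤ r) {S : ℝ → X →L[𝕜] X}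
    (hS : ∀ x : X, ContinuousOn (fun t => S t x) (Ici 0)) :
    Continuous fun p : ℝ × X => clampedFamily hr S p.1 p.2 := by
  set T : Icc (0 : ℝ) r → X →L[ℝ] X := fun t => (S t).restrictScalars ℝ
  have hT : ∀ x, Continuous fun t => T t x := fun x =>
    ((hS x).mono Icc_subset_Ici_self).domRestrict
  -- Joint continuity splits as `T(t)(z - z₀) + T(t)z₀`, where a uniform bound on the norms handles
  -- the first term.
  obtain ⟨M, hM⟩ := banach_steinhaus (g := T) fun x => by
    obtain ⟨C, hC⟩ := isCompact_univ.exists_bound_of_continuousOn (hT x).continuousOn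
    exact ⟨C, fun t => hC t (mem_univ t)⟩
  have hTc : Continuous fun p : Icc (0 : ℝ) r × X => T p.1 p.2 := by
    rw [continuous_iff_continuousAt]
    rintro ⟨t₀, z₀⟩
    have h1 : Tendsto (fun p : Icc (0 : ℝ) r × X => T p.1 (p.2 - z₀)) (𝓝 (t₀, z₀)) (𝓝 0) := by
      refine squeeze_zero_norm (a := fun p : Icc (0 : ℝ) r × X => M * ‖p.2 - z₀‖)
        (fun p => (T p.1).le_of_opNorm_le (hM p.1) _) ?_
      have : Continuous fun p : Icc (0 : ℝ) r × X => M * ‖p.2 - z₀‖ := by fun_prop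
      simpa using this.tendsto (t₀, z₀)
    have h2 : Tendsto (fun p : Icc (0 : ℝ) r × X => T p.1 z₀) (𝓝 (t₀, z₀)) (𝓝 (T t₀ z₀)) :=
      ((hT z₀).comp continuous_fst).tendsto (t₀, z₀)
    have h3 := h1.add h2
    simpa only [ContinuousAt, map_sub, sub_add_cancel, zero_add] using h3
  exact hTc.comp (((continuous_projIcc (h := hr)).comp continuous_fst).prodMk continuous_snd)

lemma IsResolventFamily.isResolventOn {α : ℝ} {A : X →ₗ.[𝕜] X} {S : ℝ → X →L[𝕜] X}
    (hS : IsResolventFamily α A S) {r : ℝ} (hr : 0 ≤ r) :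
    IsResolventOn α r (A.graph.restrictScalars ℝ) (clampedFamily hr S) where
  isClosed := hS.isClosed
  dense := by
    convert hS.dense_domain using 1
    ext x
    exact LinearPMap.mem_domain_iff.symm
  functional := fun y hy => A.graph_fst_eq_zero_snd hy rfl
  continuous := continuous_clampedFamily hr hS.strongly_continuous
  map_zero := fun z => by
    rw [clampedFamily_apply hr S ⟨le_rfl, hr⟩, hS.map_zero]; rfl
  commutes := fun t ht x y hxy => by
    obtain ⟨hx, rfl⟩ := LinearPMap.exists_apply_eq_of_mem_graph hxy
    obtain ⟨h1, h2⟩ := hS.commutes t ht.1 ⟨x, hx⟩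
    rw [clampedFamily_apply hr S ht, clampedFamily_apply hr S ht, ← h2]
    exact A.mem_graph ⟨S t x, h1⟩
  resolvent_eq := fun t ht x y hxy => by
    obtain ⟨hx, rfl⟩ := LinearPMap.exists_apply_eq_of_mem_graph hxy
    rw [clampedFamily_apply hr S ht, hS.resolvent_eq t ht.1 ⟨x, hx⟩]
    congr 1
    exact fracConv_congr α ht.1 fun s hs =>
      (clampedFamily_apply hr S ⟨hs.1, hs.2.trans ht.2⟩ _).symm

/-- Replaces `S` and `f` by globally continuous extensions and `P_α * f` by `g_{α-1} * (S * f)`, the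
form in which the results above apply. -/
lemma candidateSolution_eq {α r : ℝ} {A : X →ₗ.[𝕜] X} {S : ℝ → X →L[𝕜] X}
    (hS : IsResolventFamily α A S) (hα : 1 < α) (hr : 0 ≤ r) (x y : X) {f g : ℝ → X}
    (hg : Continuous g) (hfg : EqOn f g (Icc 0 r)) {t : ℝ} (ht : t ∈ Icc 0 r) :
    candidateSolution α S x y f t = clampedFamily hr S t x +
      fracConv 1 (fun s => clampedFamily hr S s y) t +
      fracConv (α - 1) (opConv (clampedFamily hr S) g) t := by
  have hR := hS.isResolventOn hr
  have hmem : ∀ s ∈ Icc 0 t, s ∈ Icc 0 r := fun s hs => ⟨hs.1, hs.2.trans ht.2⟩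
  rw [fracConv_opConv hR.continuous (by linarith) hg ht.1, fracConv_one, candidateSolution,
    clampedFamily_apply hr S ht]
  congr 1
  · congr 1
    refine intervalIntegral.integral_congr fun s hs => ?_
    rw [uIcc_of_le ht.1] at hs
    exact (clampedFamily_apply hr S (hmem s hs) y).symm
  · refine intervalIntegral.integral_congr fun s hs => ?_
    rw [uIcc_of_le ht.1] at hs
    simp only [resolventP, hfg (hmem s hs)]
    exact fracConv_congr _ (sub_nonneg.2 hs.2) fun σ hσ =>
      (clampedFamily_apply hr S ⟨hσ.1, hσ.2.trans (by linarith [hs.1, ht.2])⟩ _).symm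

lemma isStrongSolution_candidateSolution {α r : ℝ} {A : X →ₗ.[𝕜] X} {S : ℝ → X →L[𝕜] X}
    (hS : IsResolventFamily α A S) (hα₁ : 1 < α) (hα₂ : α < 2) (hr : 0 < r)
    (hB : HasBoundedSemivariation 0 r S) {x y : X} (hx : x ∈ A.domain) (hy : y ∈ A.domain)
    {f : ℝ → X} (hf : ContinuousOn f (Icc 0 r)) :
    IsStrongSolution α r A x y f (candidateSolution α S x y f) := by
  have hα0 : 0 < α := by linarith
  have hR := hS.isResolventOn hr.le
  obtain ⟨B, hB⟩ := (hasBoundedSemivariation_iff hr.le S).1 hB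
  set T := clampedFamily hr.le S
  set g : ℝ → X := IccExtend hr.le ((Icc 0 r).domRestrict f)
  have hg : Continuous g := hf.domRestrict.Icc_extend'
  have hfg : EqOn f g (Icc 0 r) := fun t ht =>
    (IccExtend_of_mem hr.le ((Icc 0 r).domRestrict f) ht).symm
  obtain ⟨k, hk, hgk⟩ := exists_opConv_eq_fracConv_one hR.continuous hR.map_zero hr hB hg
  obtain ⟨x', hx'⟩ := LinearPMap.mem_domain_iff.1 hx
  obtain ⟨y', hy'⟩ := LinearPMap.mem_domain_iff.1 hy
  have hTx' := hR.continuous_apply x'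
  have hTy := hR.continuous_apply y
  have hTy' := hR.continuous_apply y'
  have hJy' := continuous_fracConv one_pos hTy'
  refine isStrongSolution_of_eq_fracConv hα₁ hα₂ hr hf
    -- This is `Au + f`: here `x' = Ax`, `y' = Ay`, and the `P_α` part contributes `(k - f) + f`
    -- with `k = (S * f)'`.
    (m := fun t => T t x' + fracConv 1 (fun s => T s y') t + k t)
    (by fun_prop) (fun t ht => ?_) (fun t ht => ?_)
  · rw [candidateSolution_eq hS hα₁ hr.le x y hg hfg ht,
      IsResolventOn.fracConv_opConv_eq hα₁ hk hgk ht, hfg ht]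
    have h1 := hR.commutes t ht x x' hx'
    have h2 := fracConv_mem hR.isClosed one_pos hTy hTy' ht.1 fun s hs =>
      hR.commutes s ⟨hs.1, hs.2.trans ht.2⟩ y y' hy'
    have h3 := hR.fracConv_mem_of_opConv_eq hα₁ hr hg hk hgk t ht
    have h4 := Submodule.add_mem _ (Submodule.add_mem _ h1 h2) h3
    rwa [Prod.mk_add_mk, Prod.mk_add_mk, ← add_sub_assoc] at h4
  · have e1 : fracConv 1 (fun s => T s y) t = t • y + fracConv α (fracConv 1 fun s => T s y') t := by
      rw [fracConv_congr 1 ht.1 fun s hs => hR.resolvent_eq s ⟨hs.1, hs.2.trans ht.2⟩ y y' hy',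
        fracConv_add one_pos continuous_const (continuous_fracConv hα0 hTy'),
        fracConv_fracConv one_pos hα0 hTy' ht.1, fracConv_fracConv hα0 one_pos hTy' ht.1,
        add_comm 1 α, fracConv_one (fun _ => y), intervalIntegral.integral_const, sub_zero]
    rw [candidateSolution_eq hS hα₁ hr.le x y hg hfg ht,
      IsResolventOn.fracConv_opConv_eq hα₁ hk hgk ht, e1,
      fracConv_add hα0 (f := fun t => T t x' + fracConv 1 (fun s => T s y') t) (by fun_prop) hk,
      fracConv_add hα0 hTx' hJy',
      hR.resolvent_eq t ht x x' hx']
    abel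

/-- Zero initial data suffice: any strong solution is then `P_α * f`, so `(P_α * f)(r)` lies in the
domain of `A`. Only existence enters, which serves both equivalences. -/
lemma hasBoundedSemivariation_of_forall_isStrongSolution {α r : ℝ} {A : X →ₗ.[𝕜] X}
    {S : ℝ → X →L[𝕜] X} (hS : IsResolventFamily α A S) (hα₁ : 1 < α) (hα₂ : α < 2) (hr : 0 < r)
    (h : ∀ f : ℝ → X, ContinuousOn f (Icc 0 r) → ∃ u, IsStrongSolution α r A 0 0 f u) :
    HasBoundedSemivariation 0 r S := by
  have hR := hS.isResolventOn hr.le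
  refine (hasBoundedSemivariation_iff hr.le S).2 (hR.exists_semivariationLE hα₁ hr fun f hf => ?_)
  obtain ⟨u, hu⟩ := h f hf.continuousOn
  obtain ⟨m, hm, hmG, hmu⟩ := hu.exists_eq_fracConv hα₁ hα₂ hr
  have hr0 : r ∈ Icc 0 r := ⟨hr.le, le_rfl⟩
  have hmu' : ∀ t ∈ Icc 0 r, u t = fracConv α m t := fun t ht => by simpa using hmu t ht
  have key := hR.eq_fracConv_opConv hα₁ hr (u := fracConv α m) (w := fun t => m t - f t) hf
    (continuous_fracConv (by linarith) hm) (by fun_prop)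
    (fun t ht => by rw [← hmu' t ht]; exact hmG t ht) (fun t _ => by simp only [sub_add_cancel])
  rw [← key hr0, ← hmu' r hr0]
  exact ⟨_, hmG r hr0⟩

/-- The difference solves the integrated equation with zero data and zero forcing, so variation of
constants makes it vanish. No bound on the semivariation is needed. -/
lemma IsStrongSolution.eqOn {α r : ℝ} {A : X →ₗ.[𝕜] X}
    {S : ℝ → X →L[𝕜] X} (hS : IsResolventFamily α A S) (hα₁ : 1 < α) (hα₂ : α < 2) (hr : 0 < r)
    {x y : X} {f u v : ℝ → X} (hu : IsStrongSolution α r A x y f u)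
    (hv : IsStrongSolution α r A x y f v) : EqOn u v (Icc 0 r) := by
  have hR := hS.isResolventOn hr.le
  have hα0 : 0 < α := by linarith
  obtain ⟨m, hm, hmG, hmu⟩ := hu.exists_eq_fracConv hα₁ hα₂ hr
  obtain ⟨n, hn, hnG, hnv⟩ := hv.exists_eq_fracConv hα₁ hα₂ hr
  have hd : ∀ t ∈ Icc 0 r, u t - v t = fracConv α (fun s => m s - n s) t := fun t ht => by
    rw [hmu t ht, hnv t ht, fracConv_sub hα0 hm hn]; abel
  have key := hR.eq_fracConv_opConv hα₁ hr (u := fracConv α fun s => m s - n s)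
    (w := fun t => m t - n t) (f := fun _ => 0) continuous_const
    (continuous_fracConv hα0 (hm.sub hn)) (by fun_prop)
    (fun t ht => by
      have := A.graph.sub_mem (hmG t ht) (hnG t ht)
      rwa [Prod.mk_sub_mk, hd t ht, sub_sub_sub_cancel_right] at this)
    (fun t _ => by simp only [add_zero])
  intro t ht
  have h0 := key ht
  rw [← hd t ht] at h0
  have h1 : opConv (clampedFamily hr.le S) (fun _ => (0 : X)) = fun _ => 0 :=
    funext fun s => by simp [opConv]
  rw [h1] at h0
  exact sub_eq_zero.1 (h0.trans (by simp [fracConv]))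

end

theorem mainTheorem1 {𝕜 X : Type*} [RCLike 𝕜] [NormedAddCommGroup X]
    [NormedSpace ℝ X] [NormedSpace 𝕜 X] [IsScalarTower ℝ 𝕜 X] [CompleteSpace X]
    (α r : ℝ) (hα₁ : 1 < α) (hα₂ : α < 2) (hr : 0 < r)
    (A : X →ₗ.[𝕜] X) (S : ℝ → X →L[𝕜] X) (hS : IsResolventFamily α A S) :
    ((∀ x ∈ A.domain, ∀ y ∈ A.domain, ∀ f : ℝ → X, ContinuousOn f (Icc 0 r) →
        IsStrongSolution α r A x y f (candidateSolution α S x y f)) ↔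
      HasBoundedSemivariation 0 r S) ∧
    (HasMaximalRegularity α r A ↔ HasBoundedSemivariation 0 r S) := by
  refine ⟨⟨fun h => ?_, fun hB x hx y hy f hf =>
    isStrongSolution_candidateSolution hS hα₁ hα₂ hr hB hx hy hf⟩, fun h => ?_,
    fun hB x hx y hy f hf => ⟨candidateSolution α S x y f, ?_, fun v hv => ?_⟩⟩
  · exact hasBoundedSemivariation_of_forall_isStrongSolution hS hα₁ hα₂ hr fun f hf =>
      ⟨_, h 0 A.domain.zero_mem 0 A.domain.zero_mem f hf⟩
  · refine hasBoundedSemivariation_of_forall_isStrongSolution hS hα₁ hα₂ hr fun f hf => ?_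
    obtain ⟨u, hu, -⟩ := h 0 A.domain.zero_mem 0 A.domain.zero_mem f hf
    exact ⟨u, hu⟩
  · exact isStrongSolution_candidateSolution hS hα₁ hα₂ hr hB hx hy hf
  · exact hv.eqOn hS hα₁ hα₂ hr (isStrongSolution_candidateSolution hS hα₁ hα₂ hr hB hx hy hf)
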